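/- Let $X$ be a diffeological space, let $G$ be an abelian diffeological group (written additively), and let $\mathcal Q$ be a generating family of $X$, i.e. a set of plots $q\colon U_q\to X$, with each $U_q$ open in some $\mathbb R^n$, such that every plot $p$ of $X$, restricted to the members of some open cover of its domain, factors smoothly through plots in $\mathcal Q$. Suppose that the domain $U_q$ of every $q\in\mathcal Q$ is contractible. Let $\mathcal N(\mathcal Q)=\coprod_{q\in\mathcal Q}U_q$ be the nebula (with the sum diffeology), let $\mathrm{ev}\colon\mathcal N(\mathcal Q)\to X$ be the map $u\in U_q\mapsto q(u)$, and let $\mathcal N(\mathcal Q)_k$ be the $(k+1)$-fold fibered product of $\mathcal N(\mathcal Q)$ over $X$. Let $\check H^k(\mathcal Q,G)$ be the cohomology of the complex of the groups $C^\infty(\mathcal N(\mathcal Q)_k,G)$ of smooth maps (pointwise addition), with $\partial f=\sum_{i=0}^{k+1}(-1)^i f\circ d_i$, where $d_i$ drops the $i$-th entry. A refinement $\mathcal R$ of $\mathcal Q$ is a generating family with a map of index sets $r\mapsto q_r$ and smooth maps $f_r\colon U_r\to U_{q_r}$ such that $q_r\circ f_r=r$ for all $r\in\mathcal R$; it induces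 a homomorphism $\check H^k(\mathcal Q,G)\to\check H^k(\mathcal R,G)$, and $\check H^k(X,G)$ is the colimit of the groups $\check H^k(\mathcal Q,G)$ over all generating families and refinements. Let $R(\mathrm{ev})$ be the diffeological groupoid $\mathcal N(\mathcal Q)\times_X\mathcal N(\mathcal Q)\rightrightarrows\mathcal N(\mathcal Q)$ with source $(y_1,y_2)\mapsto y_2$, target $(y_1,y_2)\mapsto y_1$ and multiplication $(y_1,y_2)(y_2,y_3)=(y_1,y_3)$. Then: 1. The canonical homomorphism $\check H^1(\mathcal Q,G)\to\check H^1(X,G)$ is bijective. 2. There is a bijection between $\check H^1(X,G)$ and the set of smooth actions of $R(\mathrm{ev})$ on $\mathcal N(\mathcal Q)\times G$ that have the projection to $\mathcal N(\mathcal Q)$ as anchor map and commute with right translation by $G$, taken up to $(R(\mathrm{ev})\text{-}G)$-equivariant isomorphism (diffeomorphisms of $\mathcal N(\mathcal Q)\times G$ equivariant for both the groupoid actions and right translation by $G$). It sends the class represented by a $1$-cocycle $f\colon\mathcal N(\mathcal Q)_1\to G$ to the class of the action $(y_1,y_2)\cdot(y_2,g)=(y_1,f(y_1,y_2)+g)$.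 -/

import Mathlib

namespace DiffCech

open Diffeology TopologicalSpace
open scoped ContDiff DirectSum

noncomputable section

universe u v w

/-! ### Subset, product and sum diffeologies, diffeological groups

Diffeological spaces and their smooth maps are Mathlib's `DiffeologicalSpace` and `DSmooth`. -/

section Constructions

/-- The subset diffeology: the plots are the plots of `X` with values in the subset. -/
instance subtypeDiffeology {X : Type u} [DiffeologicalSpace X] (P : X → Prop) :
    DiffeologicalSpace {x : X // P x} where
  plots _ := {p | IsPlot fun x => (p x : X)}
  constant_plots _ := isPlot_const
  plot_reparam hp hf := isPlot_reparam hp hf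
  locality hp := DiffeologicalSpace.locality hp

/-- The product diffeology on an indexed product. -/
instance piDiffeology {ι : Type u} (X : ι → Type v) [∀ i, DiffeologicalSpace (X i)] :
    DiffeologicalSpace (∀ i, X i) where
  plots _ := {p | ∀ i, IsPlot fun x => p x i}
  constant_plots _ := fun _ => isPlot_const
  plot_reparam hp hf := fun i => isPlot_reparam (hp i) hf
  locality hp := fun i => DiffeologicalSpace.locality fun x =>
    let ⟨u, hu, hxu, h⟩ := hp x
    ⟨u, hu, hxu, fun hf hf' => h hf hf' i⟩

/-- The product diffeology on a product of two spaces. -/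
instance prodDiffeology (X : Type u) (Y : Type v) [DiffeologicalSpace X]
    [DiffeologicalSpace Y] : DiffeologicalSpace (X × Y) where
  plots _ := {p | (IsPlot fun x => (p x).1) ∧ IsPlot fun x => (p x).2}
  constant_plots _ := ⟨isPlot_const, isPlot_const⟩
  plot_reparam hp hf := ⟨isPlot_reparam hp.1 hf, isPlot_reparam hp.2 hf⟩
  locality hp :=
    ⟨DiffeologicalSpace.locality fun x =>
      let ⟨u, hu, hxu, h⟩ := hp x
      ⟨u, hu, hxu, fun hf hf' => (h hf hf').1⟩,
     DiffeologicalSpace.locality fun x =>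
      let ⟨u, hu, hxu, h⟩ := hp x
      ⟨u, hu, hxu, fun hf hf' => (h hf hf').2⟩⟩

/-- The sum diffeology: a parametrization is a plot if, locally around each point of its domain,
it is a plot `q : V → X i` of one of the summands followed by the inclusion of that summand.
(A plot defined on an open set `V` is a smooth map out of `V`.) -/
instance sigmaDiffeology {ι : Type u} (X : ι → Type v) [∀ i, DiffeologicalSpace (X i)] :
    DiffeologicalSpace (Σ i, X i) where
  plots n := {p | ∀ x, ∃ V : Opens (EuclideanSpace ℝ (Fin n)), x ∈ V ∧
    ∃ (i : ι) (q : V → X i), DSmooth q ∧ ∀ y : V, p y = ⟨i, q y⟩}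
  constant_plots a := fun _ => ⟨⊤, trivial, a.1, fun _ => a.2, dSmooth_const, fun _ => rfl⟩
  plot_reparam {n m p f} hp hf := fun x => by
    obtain ⟨V, hxV, i, q, hq, h⟩ := hp (f x)
    refine ⟨⟨f ⁻¹' V, V.2.preimage hf.continuous⟩, hxV, i, fun y => q ⟨f y, y.2⟩, ?_,
      fun y => h ⟨f y, y.2⟩⟩
    intro k r hr
    exact hq k (fun z => ⟨f (r z), (r z).2⟩) (hf.comp (IsPlot.contDiff (X := EuclideanSpace ℝ (Fin n)) hr)).isPlot
  locality {n p} hp := fun x => by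
    obtain ⟨u, hu, hxu, h⟩ := hp x
    obtain ⟨ε, hε, hε'⟩ := Metric.isOpen_iff.mp hu x hxu
    have hmem : ∀ z, OpenPartialHomeomorph.univBall x ε z ∈ Metric.ball x ε := fun z => by
      have := (OpenPartialHomeomorph.univBall x ε).map_source (x := z) (by simp)
      rwa [OpenPartialHomeomorph.univBall_target x hε] at this
    obtain ⟨V, hV0, i, q, hq, hqp⟩ := h (f := OpenPartialHomeomorph.univBall x ε)
      (fun z => hε' (hmem z)) OpenPartialHomeomorph.contDiff_univBall 0
    have hsymm := OpenPartialHomeomorph.contDiffOn_univBall_symm (n := (⊤ : ℕ∞)) (c := x) (r := ε)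
    let W : Opens (EuclideanSpace ℝ (Fin n)) :=
      ⟨Metric.ball x ε ∩ (OpenPartialHomeomorph.univBall x ε).symm ⁻¹' V,
        hsymm.continuousOn.isOpen_inter_preimage Metric.isOpen_ball V.2⟩
    refine ⟨W, ⟨Metric.mem_ball_self hε, ?_⟩, i,
      fun y => q ⟨(OpenPartialHomeomorph.univBall x ε).symm y, y.2.2⟩, ?_, fun y => ?_⟩
    · simpa [OpenPartialHomeomorph.univBall_symm_apply_center] using hV0
    · intro k r hr
      exact hq k (fun z => ⟨(OpenPartialHomeomorph.univBall x ε).symm (r z), (r z).2.2⟩)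
        (contDiffOn_univ.1 (hsymm.comp
          (IsPlot.contDiff (X := EuclideanSpace ℝ (Fin n)) hr).contDiffOn
          fun z _ => (r z).2.1)).isPlot
    · have := hqp ⟨(OpenPartialHomeomorph.univBall x ε).symm y, y.2.2⟩
      rw [← this]
      simp only [Function.comp_apply]
      rw [OpenPartialHomeomorph.right_inv]
      rw [OpenPartialHomeomorph.univBall_target x hε]
      exact y.2.1

end Constructions

/-- An (additively written, abelian) diffeological group: addition and negation are smooth. -/
class AbelianDiffeologicalGroup (G : Type u) [AddCommGroup G] [DiffeologicalSpace G] : Prop where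
  smooth_add : DSmooth fun p : G × G => p.1 + p.2
  smooth_neg : DSmooth fun g : G => -g

/-- The group of smooth maps from `Y` to `G`, with the pointwise operations. -/
def smoothMaps (Y : Type u) [DiffeologicalSpace Y] (G : Type v) [AddCommGroup G]
    [DiffeologicalSpace G] [AbelianDiffeologicalGroup G] : AddSubgroup (Y → G) where
  carrier := {f | DSmooth f}
  add_mem' {f g} hf hg := fun n p hp =>
    AbelianDiffeologicalGroup.smooth_add n (fun x => (f (p x), g (p x))) ⟨hf n p hp, hg n p hp⟩
  zero_mem' := dSmooth_const (y := (0 : G))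
  neg_mem' {f} hf := AbelianDiffeologicalGroup.smooth_neg.comp (f := f) hf

/-- Precomposition with a smooth map. -/
def precomp {Y : Type u} {Z : Type w} [DiffeologicalSpace Y] [DiffeologicalSpace Z] (G : Type v)
    [AddCommGroup G] [DiffeologicalSpace G] [AbelianDiffeologicalGroup G]
    (φ : Y → Z) (hφ : DSmooth φ) : smoothMaps Z G →+ smoothMaps Y G where
  toFun f := ⟨fun y => f.1 (φ y), DSmooth.comp (g := f.1) f.2 hφ⟩
  map_zero' := rfl
  map_add' _ _ := rfl

/-! ### Plots on Euclidean open sets, generating families, nebulae -/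

/-- A plot of `X` defined on an open subset of a Euclidean space. -/
structure Plot (X : Type u) [DiffeologicalSpace X] where
  /-- the dimension of the Euclidean space -/
  dim : ℕ
  /-- the domain of the plot -/
  domain : Opens (EuclideanSpace ℝ (Fin dim))
  /-- the underlying parametrization -/
  toFun : domain → X
  smooth : DSmooth toFun

/-- A (covering) generating family of `X`: a set of plots such that every plot of `X`, restricted
to the members of some open cover of its domain, factors smoothly through plots of the set. -/
structure GeneratingFamily (X : Type u) [DiffeologicalSpace X] where
  /-- the plots belonging to the family -/
  plots : Set (Plot X)
  generating : ∀ (p : Plot X) (x : p.domain),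
    ∃ (V : Opens (EuclideanSpace ℝ (Fin p.dim))) (hV : V ≤ p.domain), x.1 ∈ V ∧
      ∃ q ∈ plots, ∃ f : V → q.domain, DSmooth f ∧
        ∀ y : V, p.toFun ⟨y, hV y.2⟩ = q.toFun (f y)

variable {X : Type u} [DiffeologicalSpace X]

/-- The nebula of a generating family: the sum of the domains of its plots. -/
abbrev Nebula (Q : GeneratingFamily X) : Type u := Σ q : Q.plots, q.1.domain

/-- The evaluation map of the nebula. -/
def ev (Q : GeneratingFamily X) (y : Nebula Q) : X := y.1.1.toFun y.2

/-- The fiber product `N(Q)_k` of `k + 1` copies of the nebula over `X`. -/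
abbrev NebulaPower (Q : GeneratingFamily X) (k : ℕ) : Type u :=
  {x : Fin (k + 1) → Nebula Q // ∀ i j, ev Q (x i) = ev Q (x j)}

/-- The pair `(y₁, y₂)` as an element of `N(Q)_1`. -/
def NebulaPower.pair {Q : GeneratingFamily X} (y₁ y₂ : Nebula Q) (h : ev Q y₁ = ev Q y₂) :
    NebulaPower Q 1 :=
  ⟨![y₁, y₂], by
    intro i j
    fin_cases i <;> fin_cases j <;> simp [h]⟩

/-- The map `d_i : N(Q)_{k+1} → N(Q)_k` dropping the `i`-th entry. -/
def face (Q : GeneratingFamily X) (k : ℕ) (i : Fin (k + 2)) (x : NebulaPower Q (k + 1)) :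
    NebulaPower Q k :=
  ⟨fun j => x.1 (i.succAbove j), fun _ _ => x.2 _ _⟩

theorem smooth_face (Q : GeneratingFamily X) (k : ℕ) (i : Fin (k + 2)) :
    DSmooth (face Q k i) :=
  fun _ _ hp j => hp (i.succAbove j)

/-! ### Čech cohomology of a generating family with values in `G` -/

section Cohomology

variable (Q R : GeneratingFamily X) (G : Type v) [AddCommGroup G] [DiffeologicalSpace G]
  [AbelianDiffeologicalGroup G] (k : ℕ)

/-- Degree `k` Čech cochains of the sheaf of smooth `G`-valued maps: smooth maps `N(Q)_k → G`. -/
abbrev Cochains : Type (max u v) := smoothMaps (NebulaPower Q k) G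

/-- The coboundary `∂ f = ∑ i, (-1)^i f ∘ d_i`. -/
def coboundary : Cochains Q G k →+ Cochains Q G (k + 1) :=
  ∑ i : Fin (k + 2), ((-1 : ℤ) ^ (i : ℕ)) • precomp G (face Q k i) (smooth_face Q k i)

/-- The group of Čech cocycles. -/
def cocycles : AddSubgroup (Cochains Q G k) := (coboundary Q G k).ker

/-- The group of Čech coboundaries. -/
def coboundaries : (k : ℕ) → AddSubgroup (Cochains Q G k)
  | 0 => ⊥
  | k + 1 => (coboundary Q G k).range

/-- The Čech cohomology group of degree `k` associated to the generating family `Q`. -/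
abbrev FamilyCohomology : Type (max u v) :=
  cocycles Q G k ⧸ (coboundaries Q G k).addSubgroupOf (cocycles Q G k)

/-- A refinement `R` of `Q`: every plot of `R` factors smoothly through an assigned plot of `Q`. -/
structure Refinement where
  /-- the map of index sets -/
  index : R.plots → Q.plots
  /-- the smooth maps between the domains -/
  map : ∀ r : R.plots, r.1.domain → (index r).1.domain
  smooth : ∀ r, DSmooth (map r)
  comm : ∀ (r : R.plots) (x : r.1.domain), (index r).1.toFun (map r x) = r.1.toFun x

namespace Refinement

variable {Q R} (φ : Refinement Q R)

/-- The map of nebulae induced by a refinement. -/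
def nebulaMap (y : Nebula R) : Nebula Q := ⟨φ.index y.1, φ.map y.1 y.2⟩

theorem ev_nebulaMap (y : Nebula R) : ev Q (φ.nebulaMap y) = ev R y := φ.comm y.1 y.2

theorem smooth_nebulaMap : DSmooth φ.nebulaMap := fun n p hp x => by
  obtain ⟨V, hxV, i, q, hq, h⟩ := hp x
  exact ⟨V, hxV, φ.index i, fun y => φ.map i (q y), (φ.smooth i).comp hq, fun y => by
    simp only [Function.comp_apply]
    rw [h y]
    rfl⟩

/-- The induced map `N(R)_k → N(Q)_k`. -/
def powerMap (x : NebulaPower R k) : NebulaPower Q k :=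
  ⟨fun i => φ.nebulaMap (x.1 i), fun i j => by
    rw [ev_nebulaMap, ev_nebulaMap]; exact x.2 i j⟩

theorem smooth_powerMap : DSmooth (φ.powerMap k) :=
  fun n _ hp i => φ.smooth_nebulaMap n _ (hp i)

/-- The induced map on cochains. -/
def cochainMap : Cochains Q G k →+ Cochains R G k := precomp G (φ.powerMap k) (φ.smooth_powerMap k)

theorem cochainMap_coboundary (f : Cochains Q G k) :
    coboundary R G k (φ.cochainMap G k f) = φ.cochainMap G (k + 1) (coboundary Q G k f) := by
  simp only [coboundary, AddMonoidHom.finsetSum_apply, map_sum, AddMonoidHom.smul_apply, map_zsmul]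
  rfl

/-- The induced map on cocycles. -/
def cocycleMap : cocycles Q G k →+ cocycles R G k :=
  ((φ.cochainMap G k).comp (cocycles Q G k).subtype).codRestrict (cocycles R G k) fun f => by
    have hf : coboundary Q G k f.1 = 0 := f.2
    change coboundary R G k (φ.cochainMap G k f.1) = 0
    rw [cochainMap_coboundary, hf, map_zero]

/-- The map on cohomology induced by a refinement. -/
def cohomologyMap : FamilyCohomology Q G k →+ FamilyCohomology R G k :=
  QuotientAddGroup.map _ _ (φ.cocycleMap G k) fun f hf => by
    change φ.cochainMap G k f.1 ∈ coboundaries R G k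
    replace hf : f.1 ∈ coboundaries Q G k := hf
    cases k with
    | zero =>
      have h0 : f.1 = 0 := hf
      rw [h0, map_zero]
      exact zero_mem _
    | succ k =>
      obtain ⟨g, hg⟩ := hf
      exact ⟨φ.cochainMap G k g, by rw [cochainMap_coboundary, hg]⟩

end Refinement

variable (X)

open Classical in
/-- The relations defining the colimit: a class is identified with its image under the map induced
by any refinement. -/
def colimitRelations :
    AddSubgroup (⨁ Q : GeneratingFamily X, FamilyCohomology Q G k) :=
  AddSubgroup.closure {z | ∃ (Q R : GeneratingFamily X) (φ : Refinement Q R)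
    (a : FamilyCohomology Q G k),
    z = DirectSum.of (fun Q => FamilyCohomology Q G k) R (φ.cohomologyMap G k a) -
      DirectSum.of (fun Q => FamilyCohomology Q G k) Q a}

/-- The Čech cohomology group of `X` with values in `G`: the colimit (in abelian groups) of the
groups `FamilyCohomology Q G k` over all generating families `Q` and all refinements. -/
abbrev CechCohomology : Type (max u v) :=
  (⨁ Q : GeneratingFamily X, FamilyCohomology Q G k) ⧸ colimitRelations X G k

variable {X}

open Classical in
/-- The canonical homomorphism from the cohomology of a generating family to the colimit. -/
def toCech : FamilyCohomology Q G k →+ CechCohomology X G k :=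
  (QuotientAddGroup.mk' (colimitRelations X G k)).comp
    (DirectSum.of (fun Q => FamilyCohomology Q G k) Q)

end Cohomology

/-! ### Diffeological groupoids and their actions -/

/-- A diffeological groupoid with arrow space `H₁` and object space `H₀`; `mul (g, h)` is defined
when the source of `g` is the target of `h`. -/
structure DiffeologicalGroupoid (H₁ : Type u) (H₀ : Type v) [DiffeologicalSpace H₁]
    [DiffeologicalSpace H₀] where
  src : H₁ → H₀
  tgt : H₁ → H₀
  unit : H₀ → H₁
  inv : H₁ → H₁
  mul : {p : H₁ × H₁ // src p.1 = tgt p.2} → H₁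
  smooth_src : DSmooth src
  smooth_tgt : DSmooth tgt
  smooth_unit : DSmooth unit
  smooth_inv : DSmooth inv
  smooth_mul : DSmooth mul
  src_unit : ∀ y, src (unit y) = y
  tgt_unit : ∀ y, tgt (unit y) = y
  src_inv : ∀ h, src (inv h) = tgt h
  tgt_inv : ∀ h, tgt (inv h) = src h
  src_mul : ∀ p, src (mul p) = src p.1.2
  tgt_mul : ∀ p, tgt (mul p) = tgt p.1.1
  mul_assoc : ∀ (g h k : H₁) (hgh : src g = tgt h) (hhk : src h = tgt k),
    mul ⟨(mul ⟨(g, h), hgh⟩, k), (src_mul _).trans hhk⟩ =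
      mul ⟨(g, mul ⟨(h, k), hhk⟩), hgh.trans (tgt_mul ⟨(h, k), hhk⟩).symm⟩
  unit_mul : ∀ h, mul ⟨(unit (tgt h), h), src_unit _⟩ = h
  mul_unit : ∀ h, mul ⟨(h, unit (src h)), (tgt_unit _).symm⟩ = h
  inv_mul : ∀ h, mul ⟨(inv h, h), src_inv h⟩ = unit (src h)
  mul_inv : ∀ h, mul ⟨(h, inv h), (tgt_inv h).symm⟩ = unit (tgt h)

/-- The groupoid `R(π)` of a map `π : Y → X`: the arrows are the pairs `(y₁, y₂)` in `Y ×_X Y`,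
with source `y₂` and target `y₁`, and `(y₁, y₂)(y₂, y₃) = (y₁, y₃)`. -/
def relationGroupoid {Y : Type w} [DiffeologicalSpace Y] (π : Y → X) :
    DiffeologicalGroupoid {r : Y × Y // π r.1 = π r.2} Y where
  src r := r.1.2
  tgt r := r.1.1
  unit y := ⟨(y, y), rfl⟩
  inv r := ⟨(r.1.2, r.1.1), r.2.symm⟩
  mul p := ⟨(p.1.1.1.1, p.1.2.1.2), p.1.1.2.trans ((congrArg π p.2).trans p.1.2.2)⟩
  smooth_src := fun _ _ hp => hp.2
  smooth_tgt := fun _ _ hp => hp.1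
  smooth_unit := fun _ _ hp => ⟨hp, hp⟩
  smooth_inv := fun _ _ hp => ⟨hp.2, hp.1⟩
  smooth_mul := fun _ _ hp => ⟨hp.1.1, hp.2.2⟩
  src_unit _ := rfl
  tgt_unit _ := rfl
  src_inv _ := rfl
  tgt_inv _ := rfl
  src_mul _ := rfl
  tgt_mul _ := rfl
  mul_assoc _ _ _ _ _ := rfl
  unit_mul _ := rfl
  mul_unit _ := rfl
  inv_mul _ := rfl
  mul_inv _ := rfl

section Actions

variable {H₁ : Type u} {H₀ : Type v} [DiffeologicalSpace H₁] [DiffeologicalSpace H₀]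

/-- A smooth (left) action of the groupoid `H` on `Z` with anchor map `ρ`. -/
structure GroupoidAction (H : DiffeologicalGroupoid H₁ H₀) {Z : Type w} [DiffeologicalSpace Z]
    (ρ : Z → H₀) where
  act : {p : H₁ × Z // H.src p.1 = ρ p.2} → Z
  smooth_anchor : DSmooth ρ
  smooth_act : DSmooth act
  anchor_act : ∀ p, ρ (act p) = H.tgt p.1.1
  mul_act : ∀ (g h : H₁) (z : Z) (hgh : H.src g = H.tgt h) (hz : H.src h = ρ z),
    act ⟨(g, act ⟨(h, z), hz⟩), hgh.trans (anchor_act ⟨(h, z), hz⟩).symm⟩ =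
      act ⟨(H.mul ⟨(g, h), hgh⟩, z), (H.src_mul _).trans hz⟩
  unit_act : ∀ z, act ⟨(H.unit (ρ z), z), H.src_unit _⟩ = z

/-- Equivariant maps between two spaces acted on by the same groupoid. -/
structure IsEquivariant {H : DiffeologicalGroupoid H₁ H₀} {Z Z' : Type w} [DiffeologicalSpace Z]
    [DiffeologicalSpace Z'] {ρ : Z → H₀} {ρ' : Z' → H₀} (A : GroupoidAction H ρ)
    (B : GroupoidAction H ρ') (Φ : Z → Z') : Prop where
  smooth : DSmooth Φ
  anchor : ∀ z, ρ' (Φ z) = ρ z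
  map_act : ∀ (h : H₁) (z : Z) (hz : H.src h = ρ z),
    Φ (A.act ⟨(h, z), hz⟩) = B.act ⟨(h, Φ z), hz.trans (anchor z).symm⟩

end Actions

section NebulaActions

variable (Q : GeneratingFamily X) (G : Type v) [AddCommGroup G] [DiffeologicalSpace G]

/-- Right translation by `a` on `N(Q) × G`. -/
def translate {Q : GeneratingFamily X} {G : Type v} [AddCommGroup G] (z : Nebula Q × G) (a : G) :
    Nebula Q × G := (z.1, z.2 + a)

/-- The actions of `R(ev : N(Q) → X)` on `N(Q) × G`, with anchor map the projection to `N(Q)`,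
that commute with right translation by `G`. -/
structure NebulaAction extends GroupoidAction (relationGroupoid (ev Q))
    (Prod.fst : Nebula Q × G → Nebula Q) where
  act_translate : ∀ (r : {r : Nebula Q × Nebula Q // ev Q r.1 = ev Q r.2}) (z : Nebula Q × G)
    (hz : (relationGroupoid (ev Q)).src r = z.1) (a : G),
    act ⟨(r, translate z a), hz⟩ = translate (act ⟨(r, z), hz⟩) a

/-- `(R(ev)-G)`-equivariant isomorphism of two such actions: the existence of a diffeomorphism of
`N(Q) × G` equivariant for the groupoid actions and for right translation. -/
instance nebulaActionSetoid : Setoid (NebulaAction Q G) where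
  r A B := ∃ Φ : Nebula Q × G ≃ Nebula Q × G,
    IsEquivariant A.toGroupoidAction B.toGroupoidAction Φ ∧ DSmooth Φ.symm ∧
      ∀ z a, Φ (translate z a) = translate (Φ z) a
  iseqv := by
    refine ⟨fun A => ⟨Equiv.refl _, ⟨dSmooth_id, fun _ => rfl, fun _ _ _ => rfl⟩, dSmooth_id,
      fun _ _ => rfl⟩, ?_, ?_⟩
    · rintro A B ⟨Φ, h, h', h''⟩
      have han : ∀ z, (Φ.symm z).1 = z.1 := fun z => by
        simpa using (h.anchor (Φ.symm z)).symm
      refine ⟨Φ.symm, ⟨h', han, fun r z hz => ?_⟩, h.smooth, fun z a => ?_⟩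
      · rw [Equiv.symm_apply_eq, h.map_act]
        simp
      · rw [Equiv.symm_apply_eq, h'']
        simp
    · rintro A B C ⟨Φ, h, h', h''⟩ ⟨Ψ, k, k', k''⟩
      refine ⟨Φ.trans Ψ, ⟨k.smooth.comp h.smooth, fun z => (k.anchor _).trans (h.anchor z),
        fun r z hz => ?_⟩, h'.comp k', fun z a => ?_⟩
      · simp [h.map_act, k.map_act]
      · simp [h'', k'']

/-- The set of such actions up to `(R(ev)-G)`-equivariant isomorphism. -/
abbrev NebulaActionClasses : Type (max u v) := Quotient (nebulaActionSetoid Q G)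

end NebulaActions

end

end DiffCech

namespace DiffCech

open Diffeology TopologicalSpace
open scoped ContDiff DirectSum Topology Manifold

noncomputable section

universe u v w

/-! ### Plots on subsets of normed spaces -/

section PlotOn

variable {M : Type*} [NormedAddCommGroup M] [NormedSpace ℝ M]
  {M' : Type*} [NormedAddCommGroup M'] [NormedSpace ℝ M']
  {X : Type*} [DiffeologicalSpace X] {Y : Type*} [DiffeologicalSpace Y]

/-! A smooth `1`-cocycle `F` on the nebula is the gluing datum of a principal `G`-bundle over `X`. A
section along `p : M → X` is encoded by `IsSection` without constructing the bundle: it is a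
function on `M ×_X N(Q)` that changes by `F` along the fibres of `ev`. Plots lift locally to the
nebula, so sections along plots exist locally, and two sections differ by a smooth `G`-valued
function (`IsSection.exists_sub`).

The analytic core is that this bundle is trivial along a plot with contractible domain `U`
(`IsSmoothCocycle.exists_section`). It follows from homotopy invariance
(`exists_section_transport`). Sections are glued over tubes `V × [0, 1]`; then, since values in `G`
cannot be averaged, the partial sums of a partition of unity push the graph of a time function from
`0` to `1`, one tube at a time. A smooth approximation of the contraction joins a constant map to
the identity of `U`.

For a refinement `R` of `Q`, pullback on degree-one classes is always injective, by descent along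
local lifts. If the domains of `Q` are contractible it is also surjective: sections `s` of the
bundle of a cocycle on `R`, taken along the plots of `Q`, yield the cocycle `s u y - s u' y` on `Q`.
Refinement maps between two given families all induce the same homomorphism, and any two families
have a common refinement. Hence every class on any family comes back to `Q` compatibly with
refinement, which inverts `toCech`.

For the second claim, an action commuting with translations is determined by the elements `(a, b) ·
(b, 0)`, that is, by a cocycle, and an equivariant isomorphism is translation by a `0`-cochain, so
isomorphism of actions is cohomology of cocycles. -/

/-- A map from a normed space is a plot on the subset `O` if it sends every smooth map from a
Euclidean space into `O` to a plot. -/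
def PlotOn (O : Set M) (p : M → X) : Prop :=
  ∀ ⦃k : ℕ⦄ (c : EuclideanSpace ℝ (Fin k) → M), ContDiff ℝ ∞ c → (∀ r, c r ∈ O) →
    IsPlot fun r => p (c r)

theorem PlotOn.mono {O O' : Set M} {p : M → X} (h : PlotOn O p) (hO : O' ⊆ O) : PlotOn O' p :=
  fun _ c hc hcO => h c hc fun r => hO (hcO r)

theorem PlotOn.comp {O : Set M} {O' : Set M'} {p : M → X} {φ : M' → M} (h : PlotOn O p)
    (hφ : ContDiffOn ℝ ∞ φ O') (hO : Set.MapsTo φ O' O) : PlotOn O' fun m => p (φ m) :=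
  fun _ c hc hcO => h (fun r => φ (c r))
    (contDiffOn_univ.1 (hφ.comp hc.contDiffOn fun r _ => hcO r)) fun r => hO (hcO r)

theorem PlotOn.dSmooth_comp {O : Set M} {p : M → X} (h : PlotOn O p) {f : X → Y}
    (hf : DSmooth f) : PlotOn O fun m => f (p m) :=
  fun k c hc hcO => hf k _ (h c hc hcO)

/-- The locality axiom tests a parametrization only on smooth maps from Euclidean spaces into a
small open set, which is what `PlotOn` records. -/
theorem isPlot_of_local {n : ℕ} {p : EuclideanSpace ℝ (Fin n) → X}
    (h : ∀ x, ∃ N ∈ 𝓝 x, PlotOn N p) : IsPlot p := by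
  refine DiffeologicalSpace.locality fun x => ?_
  obtain ⟨N, hN, hp⟩ := h x
  obtain ⟨u, huN, hu, hxu⟩ := mem_nhds_iff.1 hN
  exact ⟨u, hu, hxu, fun {m f} hf hf' => hp f hf' fun r => huN (hf r)⟩

theorem IsPlot.plotOn {n : ℕ} {p : EuclideanSpace ℝ (Fin n) → X} (h : IsPlot p)
    (O : Set (EuclideanSpace ℝ (Fin n))) : PlotOn O p :=
  fun _ _ hc _ => isPlot_reparam h hc

theorem plotOn_const (O : Set M) (x : X) : PlotOn O fun _ => x :=
  fun _ _ _ _ => isPlot_const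

variable {G : Type*} [AddCommGroup G] [DiffeologicalSpace G] [AbelianDiffeologicalGroup G]

theorem IsPlot.add {n : ℕ} {p q : EuclideanSpace ℝ (Fin n) → G} (hp : IsPlot p) (hq : IsPlot q) :
    IsPlot fun x => p x + q x :=
  AbelianDiffeologicalGroup.smooth_add n (fun x => (p x, q x)) ⟨hp, hq⟩

theorem IsPlot.neg {n : ℕ} {p : EuclideanSpace ℝ (Fin n) → G} (hp : IsPlot p) :
    IsPlot fun x => -p x :=
  AbelianDiffeologicalGroup.smooth_neg n p hp

theorem IsPlot.sub {n : ℕ} {p q : EuclideanSpace ℝ (Fin n) → G} (hp : IsPlot p) (hq : IsPlot q) :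
    IsPlot fun x => p x - q x := by
  simp only [sub_eq_add_neg]
  exact IsPlot.add hp (IsPlot.neg hq)

end PlotOn

/-! ### Lifts to the nebula -/

section Lifts

variable {X : Type u} [DiffeologicalSpace X] (Q : GeneratingFamily X)

/-- Together with `PlotOn.dSmooth_subtype`, this passes between smooth maps on an open set and total
functions whose values outside it are ignored. -/
theorem plotOn_of_dSmooth_subtype {Y : Type*} [DiffeologicalSpace Y] {n : ℕ}
    {U : Opens (EuclideanSpace ℝ (Fin n))} {f : U → Y} (hf : DSmooth f)
    {p : EuclideanSpace ℝ (Fin n) → Y} (hp : ∀ u : U, p u = f u) : PlotOn (U : Set _) p :=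
  fun k c hc hcO => by
    have : (fun r => p (c r)) = fun r => f ⟨c r, hcO r⟩ := funext fun r => hp ⟨c r, hcO r⟩
    rw [this]
    exact hf k (fun r => ⟨c r, hcO r⟩) hc.isPlot

theorem PlotOn.dSmooth_subtype {Y : Type*} [DiffeologicalSpace Y] {n : ℕ}
    {U : Opens (EuclideanSpace ℝ (Fin n))} {p : EuclideanSpace ℝ (Fin n) → Y}
    (hp : PlotOn (U : Set _) p) : DSmooth fun u : U => p u :=
  fun _ c hc => hp (fun r => c r) (IsPlot.contDiff (X := EuclideanSpace ℝ (Fin n)) hc)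
    fun r => (c r).2

theorem isPlot_inclusion (q : Q.plots) {k : ℕ} {c : EuclideanSpace ℝ (Fin k) → q.1.domain}
    (hc : IsPlot c) : IsPlot fun r => (⟨q, c r⟩ : Nebula Q) :=
  fun _ => ⟨⊤, trivial, q, fun r => c r,
    fun _ _ hf => isPlot_reparam hc (IsPlot.contDiff (X := EuclideanSpace ℝ (Fin k)) hf),
    fun _ => rfl⟩

theorem dSmooth_inclusion (q : Q.plots) : DSmooth fun x : q.1.domain => (⟨q, x⟩ : Nebula Q) :=
  fun _ _ hc => isPlot_inclusion Q q hc

theorem dSmooth_ev : DSmooth (ev Q) := fun n p hp => by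
  refine isPlot_of_local fun x => ?_
  obtain ⟨V, hxV, i, q, hq, h⟩ := hp x
  refine ⟨V, V.2.mem_nhds hxV, ?_⟩
  exact plotOn_of_dSmooth_subtype (f := fun y => i.1.toFun (q y))
    (i.1.smooth.comp hq) fun y => by simp only [Function.comp_apply]; rw [h y]; rfl

/-- Plots of `X` lift locally to the nebula. -/
theorem exists_lift {n : ℕ} {U : Set (EuclideanSpace ℝ (Fin n))} (hU : IsOpen U)
    {p : EuclideanSpace ℝ (Fin n) → X} (hp : PlotOn U p) {x : EuclideanSpace ℝ (Fin n)}
    (hx : x ∈ U) : ∃ V, IsOpen V ∧ x ∈ V ∧ V ⊆ U ∧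
      ∃ a : EuclideanSpace ℝ (Fin n) → Nebula Q, PlotOn V a ∧ ∀ r ∈ V, ev Q (a r) = p r := by
  classical
  obtain ⟨V, hV, hxV, q, hq, f, hf, h⟩ := Q.generating
    ⟨n, ⟨U, hU⟩, fun u => p u, PlotOn.dSmooth_subtype (U := ⟨U, hU⟩) hp⟩ ⟨x, hx⟩
  -- The value off `V` is arbitrary; `f` at `x` merely supplies a point of the domain of `q`.
  let a : EuclideanSpace ℝ (Fin n) → Nebula Q :=
    fun r => ⟨⟨q, hq⟩, if hr : r ∈ V then f ⟨r, hr⟩ else f ⟨x, hxV⟩⟩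
  refine ⟨V, V.2, hxV, hV, a, plotOn_of_dSmooth_subtype
    ((dSmooth_inclusion Q ⟨q, hq⟩).comp hf) fun u => ?_, fun r hr => ?_⟩
  · simp [a]
  · have hr' : r ∈ V := hr
    have := h ⟨r, hr'⟩
    simp [a, ev, hr', ← this]

/-- A point of `X` is a constant plot on `ℝ⁰`, and plots lift locally. -/
theorem exists_ev_eq (x : X) : ∃ y : Nebula Q, ev Q y = x := by
  obtain ⟨V, -, h0, -, a, -, h⟩ := exists_lift Q isOpen_univ
    (plotOn_const (M := EuclideanSpace ℝ (Fin 0)) Set.univ x) (Set.mem_univ 0)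
  exact ⟨a 0, h 0 h0⟩

end Lifts

/-! ### Sections of the torsor defined by a cocycle -/

section Sections

variable {X : Type u} [DiffeologicalSpace X] {Q : GeneratingFamily X} {G : Type v} [AddCommGroup G]
  [DiffeologicalSpace G]
  {M : Type*} [NormedAddCommGroup M] [NormedSpace ℝ M]
  {M' : Type*} [NormedAddCommGroup M'] [NormedSpace ℝ M']

/-- A smooth function of two points of the nebula in the same fibre of `ev`, satisfying the
`1`-cocycle condition. Values on pairs in different fibres are irrelevant. -/
structure IsSmoothCocycle (F : Nebula Q → Nebula Q → G) : Prop where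
  add : ∀ ⦃a b c⦄, ev Q a = ev Q b → ev Q b = ev Q c → F a c = F a b + F b c
  smooth : ∀ ⦃k : ℕ⦄ ⦃a b : EuclideanSpace ℝ (Fin k) → Nebula Q⦄, IsPlot a → IsPlot b →
    (∀ r, ev Q (a r) = ev Q (b r)) → IsPlot fun r => F (a r) (b r)

/-- A section over `O`, along `p : M → X`, of the principal `G`-bundle over `X` defined by the
cocycle `F`: a function on `O ×_X N(Q)` that changes by `F` along the fibres of `ev`. -/
structure IsSection (F : Nebula Q → Nebula Q → G) (O : Set M) (p : M → X)
    (σ : M → Nebula Q → G) : Prop where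
  add : ∀ ⦃m⦄, m ∈ O → ∀ ⦃a b⦄, ev Q a = p m → ev Q b = p m → σ m b = σ m a + F a b
  smooth : ∀ ⦃k : ℕ⦄ ⦃c : EuclideanSpace ℝ (Fin k) → M⦄, ContDiff ℝ ∞ c → (∀ r, c r ∈ O) →
    ∀ ⦃a : EuclideanSpace ℝ (Fin k) → Nebula Q⦄, IsPlot a → (∀ r, ev Q (a r) = p (c r)) →
      IsPlot fun r => σ (c r) (a r)

variable {F : Nebula Q → Nebula Q → G} {O : Set M} {p : M → X} {σ τ : M → Nebula Q → G}

theorem IsSection.mono (h : IsSection F O p σ) {O' : Set M} (hO : O' ⊆ O) :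
    IsSection F O' p σ :=
  ⟨fun _ hm => h.add (hO hm), fun _ _ hc hcO => h.smooth hc fun r => hO (hcO r)⟩

theorem IsSection.comp (h : IsSection F O p σ) {O' : Set M'} {φ : M' → M}
    (hφ : ContDiffOn ℝ ∞ φ O') (hO : Set.MapsTo φ O' O) :
    IsSection F O' (fun m => p (φ m)) fun m => σ (φ m) :=
  ⟨fun _ hm => h.add (hO hm), fun _ c hc hcO => h.smooth (c := fun r => φ (c r))
    (contDiffOn_univ.1 (hφ.comp hc.contDiffOn fun r _ => hcO r)) fun r => hO (hcO r)⟩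

theorem IsSection.congr (h : IsSection F O p σ) {p' : M → X} (hp : ∀ m ∈ O, p' m = p m)
    (hτ : ∀ m ∈ O, ∀ y, ev Q y = p m → τ m y = σ m y) : IsSection F O p' τ where
  add m hm a b ha hb := by
    rw [hp m hm] at ha hb
    rw [hτ m hm _ ha, hτ m hm _ hb, h.add hm ha hb]
  smooth k c hc hcO a ha hac := by
    have hac' : ∀ r, ev Q (a r) = p (c r) := fun r => (hac r).trans (hp _ (hcO r))
    have : (fun r => τ (c r) (a r)) = fun r => σ (c r) (a r) :=
      funext fun r => hτ _ (hcO r) _ (hac' r)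
    rw [this]
    exact h.smooth hc hcO ha hac'

/-- Additivity is pointwise, and smoothness is tested along continuous maps into `O`. Neighbourhoods
are taken relative to `O` because `O` need not be open: it will often be a product with a closed
interval. -/
theorem IsSection.of_local
    (h : ∀ m ∈ O, ∃ N ∈ 𝓝 m, IsSection F (O ∩ N) p σ) : IsSection F O p σ where
  add m hm _ _ ha hb := by
    obtain ⟨N, hN, h⟩ := h m hm
    exact h.add ⟨hm, mem_of_mem_nhds hN⟩ ha hb
  smooth k c hc hcO a ha hac := by
    refine isPlot_of_local fun r => ?_
    obtain ⟨N, hN, h⟩ := h (c r) (hcO r)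
    refine ⟨c ⁻¹' N, hc.continuous.continuousAt.preimage_mem_nhds hN, fun j f hf hfN => ?_⟩
    exact h.smooth (hc.comp hf) (fun s => ⟨hcO _, hfN s⟩) (isPlot_reparam ha hf)
      fun s => hac (f s)

/-- A lift `a` of `p` to the nebula trivialises the bundle along `p`; the cocycle identity is the
additivity of the section. -/
theorem IsSmoothCocycle.isSection (hF : IsSmoothCocycle F) {a : M → Nebula Q} (ha : PlotOn O a)
    (hp : ∀ m ∈ O, ev Q (a m) = p m) : IsSection F O p fun m => F (a m) where
  add m hm _ _ hb hc := hF.add ((hp m hm).trans hb.symm) (hb.trans hc.symm)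
  smooth _ c hc hcO _ hb hbc := hF.smooth (ha c hc hcO) hb
    fun r => (hp _ (hcO r)).trans (hbc r).symm

theorem IsSmoothCocycle.self (hF : IsSmoothCocycle F) (a : Nebula Q) : F a a = 0 := by
  simpa using hF.add (a := a) (b := a) (c := a) rfl rfl

/-- Sections along a plot exist locally. -/
theorem IsSmoothCocycle.exists_local_section (hF : IsSmoothCocycle F) {n : ℕ}
    {U : Set (EuclideanSpace ℝ (Fin n))} (hU : IsOpen U) {p : EuclideanSpace ℝ (Fin n) → X}
    (hp : PlotOn U p) {x : EuclideanSpace ℝ (Fin n)} (hx : x ∈ U) :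
    ∃ V, IsOpen V ∧ x ∈ V ∧ V ⊆ U ∧ ∃ σ, IsSection F V p σ := by
  obtain ⟨V, hV, hxV, hVU, a, ha, h⟩ := exists_lift Q hU hp hx
  exact ⟨V, hV, hxV, hVU, _, hF.isSection ha h⟩

variable [AbelianDiffeologicalGroup G]

theorem IsSection.add_plot (h : IsSection F O p σ) {d : M → G} (hd : PlotOn O d) :
    IsSection F O p fun m y => σ m y + d m where
  add m hm a b ha hb := by
    rw [h.add hm ha hb]
    abel
  smooth k c hc hcO a ha hac := IsPlot.add (h.smooth hc hcO ha hac) (hd c hc hcO)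

/-- Two sections differ by a smooth function with values in `G`. -/
theorem IsSection.exists_sub (hσ : IsSection F O p σ) (hτ : IsSection F O p τ) (hp : PlotOn O p) :
    ∃ d : M → G, PlotOn O d ∧ ∀ m ∈ O, ∀ y, ev Q y = p m → τ m y = σ m y + d m := by
  -- `Y` need not be smooth. Both sections change by `F` along the fibre, so their difference does
  -- not depend on the point chosen there and can be computed along smooth local lifts.
  choose Y hY using exists_ev_eq Q
  have key : ∀ m ∈ O, ∀ y, ev Q y = p m →
      τ m y - σ m y = τ m (Y (p m)) - σ m (Y (p m)) := fun m hm y hy => by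
    rw [hτ.add hm (hY (p m)) hy, hσ.add hm (hY (p m)) hy]
    abel
  refine ⟨fun m => τ m (Y (p m)) - σ m (Y (p m)), fun k c hc hcO => ?_, fun m hm y hy => ?_⟩
  · refine isPlot_of_local fun r => ?_
    obtain ⟨V, hV, hrV, -, a, ha, hap⟩ := exists_lift Q isOpen_univ
      (IsPlot.plotOn (hp c hc hcO) Set.univ) (Set.mem_univ r)
    refine ⟨V, hV.mem_nhds hrV, fun j f hf hfV => ?_⟩
    have : (fun s => τ (c (f s)) (Y (p (c (f s)))) - σ (c (f s)) (Y (p (c (f s))))) =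
        fun s => τ (c (f s)) (a (f s)) - σ (c (f s)) (a (f s)) :=
      funext fun s => (key _ (hcO _) _ (hap _ (hfV s))).symm
    rw [this]
    exact IsPlot.sub (hτ.smooth (hc.comp hf) (fun s => hcO _) (ha f hf hfV) fun s => hap _ (hfV s))
      (hσ.smooth (hc.comp hf) (fun s => hcO _) (ha f hf hfV) fun s => hap _ (hfV s))
  · change _ = _ + (τ m (Y (p m)) - σ m (Y (p m)))
    rw [← key m hm y hy]
    abel

end Sections

/-! ### Transport of sections along a homotopy -/

section Gluing

variable {X : Type u} [DiffeologicalSpace X] {Q : GeneratingFamily X} {G : Type v} [AddCommGroup G]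
  [DiffeologicalSpace G] [AbelianDiffeologicalGroup G]
  {M : Type*} [NormedAddCommGroup M] [NormedSpace ℝ M]
  {F : Nebula Q → Nebula Q → G}

/-- There is a smooth map of the line into an interval that is the identity near the midpoint. -/
theorem exists_contDiff_retraction {a b : ℝ} (hab : a < b) :
    ∃ (κ : ℝ → ℝ) (r : ℝ), 0 < r ∧ a < (a + b) / 2 - r ∧ ContDiff ℝ ∞ κ ∧
      (∀ t, κ t ∈ Set.Icc a b) ∧ ∀ t, |t - (a + b) / 2| ≤ r → κ t = t := by
  have hr : 0 < (b - a) / 4 := by linarith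
  -- With `c` the midpoint, take `κ t = c + χ t * (t - c)`: it is `t` where `χ = 1`, and since `χ`
  -- vanishes beyond distance `(b - a) / 2` the values never leave `[a, b]`.
  let χ : ContDiffBump ((a + b) / 2) := ⟨(b - a) / 4, (b - a) / 2, hr, by linarith⟩
  refine ⟨fun t => (a + b) / 2 + χ t * (t - (a + b) / 2), (b - a) / 4, hr, by linarith, ?_, ?_, ?_⟩
  · exact contDiff_const.add (χ.contDiff.mul (contDiff_id.sub contDiff_const))
  · intro t
    have h : |χ t * (t - (a + b) / 2)| ≤ (b - a) / 2 := by
      rw [abs_mul, abs_of_nonneg χ.nonneg]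
      rcases le_or_gt ((b - a) / 2) (|t - (a + b) / 2|) with ht | ht
      · rw [χ.zero_of_le_dist (by rwa [Real.dist_eq])]
        simp only [zero_mul]
        linarith
      · calc χ t * |t - (a + b) / 2| ≤ 1 * |t - (a + b) / 2| := by
              gcongr
              exact χ.le_one
          _ ≤ _ := by linarith
    rw [abs_le] at h
    constructor <;> simp only <;> linarith [h.1, h.2]
  · intro t ht
    have : χ t = 1 := χ.one_of_mem_closedBall (by rwa [Metric.mem_closedBall, Real.dist_eq])
    simp [this]

/-- Sections over `O × [0, b]` and `O × [a, d]` with `a < b` give a section over `O × [0, d]`. -/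
theorem exists_section_glue {O : Set M} {P : M × ℝ → X} (hP : PlotOn (O ×ˢ Set.univ) P)
    {a b d : ℝ} (hab : a < b) (hb : 0 < b) {σ τ : M × ℝ → Nebula Q → G}
    (hσ : IsSection F (O ×ˢ Set.Icc 0 b) P σ) (hτ : IsSection F (O ×ˢ Set.Icc a d) P τ) :
    ∃ ρ, IsSection F (O ×ˢ Set.Icc 0 d) P ρ := by
  classical
  rcases le_or_gt d b with hdb | hbd
  · exact ⟨σ, hσ.mono (Set.prod_mono le_rfl (Set.Icc_subset_Icc_right hdb))⟩
  have hl : max a 0 < b := max_lt hab hb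
  have h1 : O ×ˢ Set.Icc (max a 0) b ⊆ O ×ˢ Set.Icc 0 b :=
    Set.prod_mono le_rfl (Set.Icc_subset_Icc_left (le_max_right _ _))
  have h2 : O ×ˢ Set.Icc (max a 0) b ⊆ O ×ˢ Set.Icc a d :=
    Set.prod_mono le_rfl (Set.Icc_subset_Icc (le_max_left _ _) hbd.le)
  obtain ⟨e, he, hστ⟩ := (hσ.mono h1).exists_sub (hτ.mono h2)
    (hP.mono (Set.prod_mono le_rfl (Set.subset_univ _)))
  obtain ⟨κ, r, hr, har, hκ, hκmem, hκeq⟩ := exists_contDiff_retraction hl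
  set m := (max a 0 + b) / 2 with hm
  have ha0 := le_max_left a 0
  have ha0' := le_max_right a 0
  -- The difference `e` is smooth only over the overlap; composing time with `κ` extends it to all
  -- times. The corrected `τ` equals `σ` within `r` of `m`, so switching there is smooth.
  have hτ' : IsSection F (O ×ˢ Set.Icc a d) P fun z y => τ z y + -e (z.1, κ z.2) :=
    hτ.add_plot (PlotOn.dSmooth_comp (he.comp (φ := fun z : M × ℝ => (z.1, κ z.2))
      (contDiff_fst.prodMk (hκ.comp contDiff_snd)).contDiffOn
      fun z hz => ⟨hz.1, hκmem _⟩) AbelianDiffeologicalGroup.smooth_neg)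
  refine ⟨fun z y => if z.2 < m then σ z y else τ z y + -e (z.1, κ z.2), IsSection.of_local ?_⟩
  rintro ⟨u, t⟩ ⟨hu, ht⟩
  rcases lt_or_ge t m with htm | htm
  · refine ⟨{z | z.2 < m}, (isOpen_lt continuous_snd continuous_const).mem_nhds htm, ?_⟩
    refine (hσ.mono ?_).congr (fun _ _ => rfl) fun z hz y hy => if_pos hz.2
    rintro ⟨v, s⟩ ⟨⟨hv, hs⟩, hsm⟩
    refine ⟨hv, hs.1, ?_⟩
    have : s < m := hsm
    change s ≤ b
    linarith
  · refine ⟨{z | m - r < z.2}, (isOpen_lt continuous_const continuous_snd).mem_nhds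
      (show m - r < t by linarith), ?_⟩
    refine (hτ'.mono ?_).congr (fun _ _ => rfl) fun z hz y hy => ?_
    · rintro ⟨v, s⟩ ⟨⟨hv, hs⟩, hsm⟩
      refine ⟨hv, ?_, hs.2⟩
      have : m - r < s := hsm
      change a ≤ s
      linarith
    · by_cases hzm : z.2 < m
      · have h3 : m - r < z.2 := hz.2
        rw [if_pos hzm, hκeq _ (by rw [abs_le]; constructor <;> linarith),
          hστ z ⟨hz.1.1, by constructor <;> linarith⟩ y hy]
        simp
      · exact if_neg hzm

/-- If sections exist locally, then they exist over a neighbourhood of each `{u} × [0, 1]`. -/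
theorem exists_section_tube {U : Set M} {P : M × ℝ → X} (hP : PlotOn (U ×ˢ Set.univ) P)
    (hloc : ∀ z ∈ U ×ˢ (Set.univ : Set ℝ), ∃ N ∈ 𝓝 z, ∃ σ, IsSection F N P σ)
    {u : M} (hu : u ∈ U) :
    ∃ V, IsOpen V ∧ u ∈ V ∧ ∃ σ, IsSection F ((U ∩ V) ×ˢ Set.Icc (0 : ℝ) 1) P σ := by
  have hloc' : ∀ s : ℝ, ∃ N, IsOpen N ∧ (u, s) ∈ N ∧ ∃ σ, IsSection F N P σ := fun s => by
    obtain ⟨N, hN, σ, hσ⟩ := hloc (u, s) ⟨hu, trivial⟩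
    obtain ⟨W, hWN, hW, hx⟩ := mem_nhds_iff.1 hN
    exact ⟨W, hW, hx, σ, hσ.mono hWN⟩
  choose N hNo hN hNσ using hloc'
  obtain ⟨t, ht0, htm, ⟨n, hn⟩, htc⟩ := exists_monotone_Icc_subset_open_cover_unitInterval
    (c := fun s : ℝ => {x : unitInterval | (u, (x : ℝ)) ∈ N s})
    (fun s => (hNo s).preimage (by fun_prop))
    fun x _ => Set.mem_iUnion.2 ⟨x, hN x⟩
  -- The strict inequality `t i < b` provides the overlap of positive length that
  -- `exists_section_glue` requires at the next step.
  have step : ∀ i, ∃ V, IsOpen V ∧ u ∈ V ∧ ∃ b : ℝ, (t i : ℝ) < b ∧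
      ∃ σ, IsSection F ((U ∩ V) ×ˢ Set.Icc (0 : ℝ) b) P σ := by
    intro i
    induction i with
    | zero =>
      obtain ⟨σ, hσ⟩ := hNσ 0
      obtain ⟨V, W, hV, hW, huV, h0, hVW⟩ := isOpen_prod_iff.1 (hNo 0) u 0 (hN 0)
      obtain ⟨ε, hε, hεW⟩ := Metric.isOpen_iff.1 hW 0 h0
      refine ⟨V, hV, huV, ε / 2, by simpa [ht0] using hε, σ, hσ.mono ?_⟩
      rintro ⟨v, s⟩ ⟨hv, hs⟩
      refine hVW ⟨hv.2, hεW ?_⟩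
      rw [Metric.mem_ball, Real.dist_eq, sub_zero, abs_of_nonneg hs.1]
      exact hs.2.trans_lt (by linarith)
    | succ i ih =>
      obtain ⟨V, hV, huV, b, hb, σ, hσ⟩ := ih
      obtain ⟨s, hs⟩ := htc i
      obtain ⟨τ, hτ⟩ := hNσ s
      have hsub : ({u} : Set M) ×ˢ Set.Icc (t i : ℝ) (t (i + 1)) ⊆ N s := by
        rintro ⟨v, x⟩ ⟨hv, hx⟩
        have hv' : v = u := hv
        subst hv'
        exact hs (a := ⟨x, (t i).2.1.trans hx.1, hx.2.trans (t (i + 1)).2.2⟩) ⟨hx.1, hx.2⟩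
      obtain ⟨V', W, hV', hW, huV', htW, hVW⟩ := generalized_tube_lemma
        isCompact_singleton isCompact_Icc (hNo s) hsub
      have hmono : (t i : ℝ) ≤ t (i + 1) := htm i.le_succ
      obtain ⟨ε, hε, hεW⟩ := Metric.isOpen_iff.1 hW (t i) (htW ⟨le_rfl, hmono⟩)
      obtain ⟨δ, hδ, hδW⟩ := Metric.isOpen_iff.1 hW (t (i + 1)) (htW ⟨hmono, le_rfl⟩)
      -- The interval is enlarged at both ends: on the left to overlap `[0, b]`, on the right to
      -- keep a margin beyond `t (i + 1)` for the induction.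
      have hτ' : IsSection F ((U ∩ (V ∩ V')) ×ˢ
          Set.Icc ((t i : ℝ) - ε / 2) ((t (i + 1) : ℝ) + δ / 2)) P τ := by
        refine hτ.mono ?_
        rintro ⟨v, x⟩ ⟨hv, hx⟩
        refine hVW ⟨hv.2.2, ?_⟩
        change x ∈ W
        obtain ⟨hx1, hx2⟩ := hx
        simp only at hx1 hx2
        rcases lt_or_ge x (t i) with h | h
        · exact hεW (by rw [Metric.mem_ball, Real.dist_eq, abs_lt]; constructor <;> linarith)
        · rcases le_or_gt x (t (i + 1)) with h' | h'
          · exact htW ⟨h, h'⟩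
          · exact hδW (by rw [Metric.mem_ball, Real.dist_eq, abs_lt]; constructor <;> linarith)
      obtain ⟨ρ, hρ⟩ := exists_section_glue
        (hP.mono (Set.prod_mono Set.inter_subset_left le_rfl)) (by linarith)
        ((t i).2.1.trans_lt hb)
        (hσ.mono (Set.prod_mono (Set.inter_subset_inter_right _ Set.inter_subset_left) le_rfl)) hτ'
      exact ⟨V ∩ V', hV.inter hV', ⟨huV, huV' rfl⟩, _, by linarith, ρ, hρ⟩
  obtain ⟨V, hV, huV, b, hb, σ, hσ⟩ := step n
  rw [hn n le_rfl] at hb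
  exact ⟨V, hV, huV, σ, hσ.mono (Set.prod_mono le_rfl (Set.Icc_subset_Icc_right hb.le))⟩

/-- Moving a section along `u ↦ (u, s u)` to one along `u ↦ (u, s' u)`, where `s` and `s'` differ
only inside an open set `V` over which a section along `V × [0, 1]` is given. -/
theorem exists_section_step {U V : Set M} (hV : IsOpen V) {P : M × ℝ → X}
    (hP : PlotOn (U ×ˢ Set.univ) P) {σ : M × ℝ → Nebula Q → G}
    (hσ : IsSection F ((U ∩ V) ×ˢ Set.Icc (0 : ℝ) 1) P σ) {s s' : M → ℝ}
    (hs : ContDiffOn ℝ ∞ s U) (hs' : ContDiffOn ℝ ∞ s' U)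
    (hsI : ∀ u ∈ U, s u ∈ Set.Icc (0 : ℝ) 1) (hsI' : ∀ u ∈ U, s' u ∈ Set.Icc (0 : ℝ) 1)
    (hss' : ∀ u ∈ U, u ∉ V → ∃ N ∈ 𝓝 u, ∀ v ∈ U ∩ N, s' v = s v)
    {θ : M → Nebula Q → G} (hθ : IsSection F U (fun u => P (u, s u)) θ) :
    ∃ θ', IsSection F U (fun u => P (u, s' u)) θ' ∧
      ∀ u ∈ U, s' u = s u → ∀ y, ev Q y = P (u, s u) → θ' u y = θ u y := by
  classical
  have hg : ∀ {r : M → ℝ}, ContDiffOn ℝ ∞ r U → ContDiffOn ℝ ∞ (fun u => (u, r u)) (U ∩ V) :=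
    fun hr => (contDiffOn_id.prodMk hr).mono Set.inter_subset_left
  have hσs := hσ.comp (hg hs) fun u hu => ⟨hu, hsI u hu.1⟩
  obtain ⟨d, hd, hdθ⟩ := hσs.exists_sub (hθ.mono Set.inter_subset_left)
    (hP.comp (hg hs) fun u hu => ⟨hu.1, trivial⟩)
  have heq : ∀ u ∈ U, s' u = s u → ∀ y, ev Q y = P (u, s u) →
      (if u ∈ V then σ (u, s' u) y + d u else θ u y) = θ u y := fun u hu h y hy => by
    split_ifs with huV
    · rw [h, hdθ u ⟨hu, huV⟩ y hy]
    · rfl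
  -- Over `V`, `θ` is `σ` along the graph of `s` plus `d`; slide `σ` to the graph of `s'` and keep
  -- `d`. Near a point of `U` outside `V` the two graphs coincide, so there the new section is just
  -- `θ`.
  refine ⟨fun u y => if u ∈ V then σ (u, s' u) y + d u else θ u y, IsSection.of_local ?_, heq⟩
  intro u hu
  by_cases huV : u ∈ V
  · refine ⟨V, hV.mem_nhds huV, ?_⟩
    exact ((hσ.comp (hg hs') fun u hu => ⟨hu, hsI' u hu.1⟩).add_plot hd).congr
      (fun _ _ => rfl) fun v hv y _ => if_pos hv.2
  · obtain ⟨N, hN, h⟩ := hss' u hu huV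
    refine ⟨N, hN, (hθ.mono Set.inter_subset_left).congr (fun v hv => by rw [h v hv])
      fun v hv y hy => heq v hv.1 (h v hv) y hy⟩

end Gluing

/-! ### Smooth partitions of unity indexed by the natural numbers -/

section Partition

variable {E : Type*} [NormedAddCommGroup E] [NormedSpace ℝ E] [FiniteDimensional ℝ E]

/-- A countable smooth partition of unity on an open subset of a finite-dimensional space. -/
theorem exists_contDiffOn_partition {U : Set E} (hU : IsOpen U) (hne : U.Nonempty)
    {V : E → Set E} (hV : ∀ u ∈ U, IsOpen (V u)) (hVu : ∀ u ∈ U, u ∈ V u) :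
    ∃ (x : ℕ → E) (f : ℕ → E → ℝ), (∀ i, x i ∈ U) ∧ (∀ i, ContDiffOn ℝ ∞ (f i) U) ∧
      (∀ i, ∀ u ∈ U, 0 ≤ f i u) ∧
      (∀ i, ∀ u ∈ U, u ∉ V (x i) → ∃ N ∈ 𝓝 u, ∀ v ∈ U ∩ N, f i v = 0) ∧
      ∀ u ∈ U, ∃ N ∈ 𝓝 u, ∃ k, ∀ v ∈ U ∩ N, (∀ i ≥ k, f i v = 0) ∧
        ∑ i ∈ Finset.range k, f i v = 1 := by
  classical
  let U' : Opens E := ⟨U, hU⟩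
  have : Nonempty U' := hne.to_subtype
  have : SecondCountableTopology E := secondCountable_of_proper
  have : LocallyCompactSpace U' := hU.locallyCompactSpace
  have : SigmaCompactSpace U' := sigmaCompactSpace_of_locallyCompact_secondCountable
  let V' : U' → Set U' := fun u => Subtype.val ⁻¹' V u
  have hV' : ∀ u, IsOpen (V' u) := fun u => (hV u u.2).preimage continuous_subtype_val
  -- Countability, from the Lindelöf property, lets the tubes be treated one after another. As `U`
  -- is nonempty so is `S`, hence it is the range of a sequence, possibly with repetitions.
  obtain ⟨S, hS, hSc⟩ := TopologicalSpace.countable_cover_nhds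
    fun u : U' => (hV' u).mem_nhds (show u ∈ V' u from hVu u u.2)
  have hSne : S.Nonempty := by
    by_contra h
    rw [Set.not_nonempty_iff_eq_empty] at h
    simp only [h, Set.mem_empty_iff_false, Set.iUnion_of_empty, Set.iUnion_empty] at hSc
    exact Set.empty_ne_univ hSc
  obtain ⟨x, hx⟩ := hS.exists_eq_range hSne
  obtain ⟨f, hf⟩ := SmoothPartitionOfUnity.exists_isSubordinate 𝓘(ℝ, E) (s := Set.univ)
    isClosed_univ (fun i => V' (x i)) (fun i => hV' _) (by rw [← hSc, hx]; simp)
  have hval : ∀ i (u : U'), Function.extend Subtype.val (f i) 0 (u : E) = f i u :=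
    fun i u => Subtype.val_injective.extend_apply _ _ _
  have hnhds : ∀ {u : E} (hu : u ∈ U) {N : Set U'}, N ∈ 𝓝 (⟨u, hu⟩ : U') →
      Subtype.val '' N ∈ 𝓝 u := fun {u} hu {N} hN =>
    hU.isOpenEmbedding_subtypeVal.image_mem_nhds.2 hN
  refine ⟨fun i => x i, fun i => Function.extend Subtype.val (f i) 0, fun i => (x i).2,
    fun i u hu => ?_, fun i u hu => ?_, fun i u hu huV => ?_, fun u hu => ?_⟩
  · have h : ContMDiffAt 𝓘(ℝ, E) 𝓘(ℝ, ℝ) ∞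
        (fun z : U' => Function.extend Subtype.val (f i) 0 (z : E)) ⟨u, hu⟩ := by
      simp only [hval]
      exact (f i).contMDiff _
    exact (contMDiffAt_subtype_iff.1 h).contDiffAt.contDiffWithinAt
  · have := f.nonneg i ⟨u, hu⟩
    rwa [← hval] at this
  · have h : (⟨u, hu⟩ : U') ∉ tsupport (f i) := fun h => huV (hf i h)
    have h' : (tsupport (f i))ᶜ ∈ 𝓝 (⟨u, hu⟩ : U') :=
      (isClosed_tsupport (f i)).isOpen_compl.mem_nhds h
    refine ⟨_, hnhds hu h', ?_⟩
    rintro _ ⟨-, v, hv, rfl⟩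
    simp only [hval]
    exact image_eq_zero_of_notMem_tsupport hv
  · obtain ⟨N, hN, hfin⟩ := f.locallyFinite ⟨u, hu⟩
    obtain ⟨k, hk⟩ := hfin.bddAbove
    -- `k` bounds the indices active on `N` and may itself be active.
    refine ⟨_, hnhds hu hN, k + 1, ?_⟩
    rintro _ ⟨-, v, hv, rfl⟩
    simp only [hval]
    have h0 : ∀ i ≥ k + 1, f i v = 0 := fun i hi => by
      by_contra h
      have := hk (show i ∈ _ from ⟨v, h, hv⟩)
      omega
    refine ⟨h0, ?_⟩
    rw [← f.sum_eq_one (x := v) trivial]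
    refine (finsum_eq_sum_of_support_subset _ fun i hi => ?_).symm
    simp only [Finset.coe_range, Set.mem_Iio]
    by_contra h
    exact hi (h0 i (not_lt.1 h))

end Partition

/-! ### Homotopy invariance of the existence of sections -/

section Transport

variable {X : Type u} [DiffeologicalSpace X] {Q : GeneratingFamily X} {G : Type v} [AddCommGroup G]
  [DiffeologicalSpace G] [AbelianDiffeologicalGroup G]
  {M : Type*} [NormedAddCommGroup M] [NormedSpace ℝ M] [FiniteDimensional ℝ M]
  {F : Nebula Q → Nebula Q → G}

/-- Homotopy invariance: a section at time `0` yields a section at time `1`. -/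
theorem exists_section_transport {U : Set M} (hU : IsOpen U) (hne : U.Nonempty) {P : M × ℝ → X}
    (hP : PlotOn (U ×ˢ Set.univ) P)
    (hloc : ∀ z ∈ U ×ˢ (Set.univ : Set ℝ), ∃ N ∈ 𝓝 z, ∃ σ, IsSection F N P σ)
    (h0 : ∃ σ, IsSection F U (fun u => P (u, 0)) σ) :
    ∃ σ, IsSection F U (fun u => P (u, 1)) σ := by
  classical
  have htube : ∀ u, ∃ V, u ∈ U → IsOpen V ∧ u ∈ V ∧
      ∃ σ, IsSection F ((U ∩ V) ×ˢ Set.Icc (0 : ℝ) 1) P σ := fun u => by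
    by_cases hu : u ∈ U
    · obtain ⟨V, h⟩ := exists_section_tube hP hloc hu
      exact ⟨V, fun _ => h⟩
    · exact ⟨∅, fun h => absurd h hu⟩
  choose V hV using htube
  obtain ⟨x, f, hx, hf, hf0, hfV, hfin⟩ := exists_contDiffOn_partition hU hne
    (fun u hu => (hV u hu).1) fun u hu => (hV u hu).2.1
  -- The time functions increase from `s 0 = 0` and are locally equal to `1` from some index on.
  -- From `s k` to `s (k + 1)` the graph moves only inside the tube over `V (x k)`.
  let s : ℕ → M → ℝ := fun k u => ∑ i ∈ Finset.range k, f i u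
  have hs : ∀ k, ContDiffOn ℝ ∞ (s k) U := fun k => ContDiffOn.sum fun i _ => hf i
  have hs1 : ∀ {u k}, u ∈ U → (∀ i ≥ k, f i u = 0) → ∑ i ∈ Finset.range k, f i u = 1 →
      ∀ j ≥ k, s j u = 1 := fun {u k} _ h h' j hj => by
    rw [← h']
    refine (Finset.sum_subset (Finset.range_mono hj) fun i _ hi => h i ?_).symm
    simpa using hi
  have hmono : ∀ u ∈ U, Monotone fun k => s k u := fun u hu =>
    monotone_nat_of_le_succ fun k => by
      simp only [s, Finset.sum_range_succ]
      linarith [hf0 k u hu]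
  have hsI : ∀ k, ∀ u ∈ U, s k u ∈ Set.Icc (0 : ℝ) 1 := fun k u hu => by
    refine ⟨Finset.sum_nonneg fun i _ => hf0 i u hu, ?_⟩
    obtain ⟨N, hN, j, h⟩ := hfin u hu
    obtain ⟨h1, h2⟩ := h u ⟨hu, mem_of_mem_nhds hN⟩
    rw [← hs1 hu h1 h2 (max j k) (le_max_left _ _)]
    exact hmono u hu (le_max_right _ _)
  -- The hypothesis on `θ` sits inside the existential so that `choose` gives an operator on
  -- arbitrary functions, which can be iterated.
  have hstep : ∀ (k : ℕ) (θ : M → Nebula Q → G), ∃ θ' : M → Nebula Q → G,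
      IsSection F U (fun u => P (u, s k u)) θ → IsSection F U (fun u => P (u, s (k + 1) u)) θ' ∧
        ∀ u ∈ U, s (k + 1) u = s k u → ∀ y, ev Q y = P (u, s k u) → θ' u y = θ u y := by
    intro k θ
    by_cases hθ : IsSection F U (fun u => P (u, s k u)) θ
    · obtain ⟨σ, hσ⟩ := (hV (x k) (hx k)).2.2
      obtain ⟨θ', h⟩ := exists_section_step (hV (x k) (hx k)).1 hP hσ (hs k) (hs (k + 1)) (hsI k)
        (hsI (k + 1)) (fun u hu huV => by
          obtain ⟨N, hN, h⟩ := hfV k u hu huV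
          exact ⟨N, hN, fun v hv => by simp [s, Finset.sum_range_succ, h v hv]⟩) hθ
      exact ⟨θ', fun _ => h⟩
    · exact ⟨θ, fun h => absurd h hθ⟩
  choose step hstep using hstep
  obtain ⟨θ₀, hθ₀⟩ := h0
  let θ : ℕ → M → Nebula Q → G := fun k => Nat.rec θ₀ step k
  have hθ : ∀ k, IsSection F U (fun u => P (u, s k u)) (θ k) := fun k => by
    induction k with
    | zero => simpa [s, θ] using hθ₀
    | succ k ih => exact (hstep k (θ k) ih).1
  have hconst : ∀ {u k}, u ∈ U → (∀ i ≥ k, s i u = 1) → ∀ y, ev Q y = P (u, 1) → ∀ j ≥ k,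
      θ j u y = θ k u y := fun {u k} hu h y hy j hj => by
    induction j, hj using Nat.le_induction with
    | base => rfl
    | succ j hj ih =>
      rw [← ih]
      refine (hstep j (θ j) (hθ j)).2 u hu ?_ y ?_
      · rw [h j hj, h (j + 1) (by omega)]
      · rw [h j hj, hy]
  have hfin' : ∀ u, ∃ k, u ∈ U → ∃ N ∈ 𝓝 u, ∀ v ∈ U ∩ N, ∀ i ≥ k, s i v = 1 := fun u => by
    by_cases hu : u ∈ U
    · obtain ⟨N, hN, k, h⟩ := hfin u hu
      exact ⟨k, fun _ => ⟨N, hN, fun v hv => hs1 hv.1 (h v hv).1 (h v hv).2⟩⟩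
    · exact ⟨0, fun h => absurd h hu⟩
  choose K hK using hfin'
  -- The stage depends on the point, but the sequence is stationary once the time is `1`. Comparing
  -- at stage `max (K u) (K v)` shows that near `u` the limit is the single section `θ (K u)`.
  refine ⟨fun u => θ (K u) u, IsSection.of_local fun u hu => ?_⟩
  obtain ⟨N, hN, h⟩ := hK u hu
  refine ⟨N, hN, ((hθ (K u)).mono Set.inter_subset_left).congr
    (fun v hv => by rw [h v hv _ le_rfl]) fun v hv y hy => ?_⟩
  rw [h v hv _ le_rfl] at hy
  obtain ⟨N', hN', h'⟩ := hK v hv.1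
  rw [← hconst hv.1 (h' v ⟨hv.1, mem_of_mem_nhds hN'⟩) y hy (max (K u) (K v)) (le_max_right _ _),
    hconst hv.1 (h v hv) y hy (max (K u) (K v)) (le_max_left _ _)]

end Transport

/-! ### Sections along plots with contractible domain -/

section Contraction

/-- A continuous positive function bounded by the distance to the complement of an open set. -/
theorem exists_continuous_ball_subset {E : Type*} [PseudoMetricSpace E] {U : Set E}
    (hU : IsOpen U) :
    ∃ ε : E → ℝ, Continuous ε ∧ ∀ x ∈ U, 0 < ε x ∧ Metric.ball x (ε x) ⊆ U := by
  rcases Set.eq_empty_or_nonempty Uᶜ with h | h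
  · rw [Set.compl_empty_iff] at h
    exact ⟨fun _ => 1, continuous_const, fun x _ => ⟨one_pos, by simp [h]⟩⟩
  · refine ⟨fun x => Metric.infDist x Uᶜ, Metric.continuous_infDist_pt _, fun x hx => ⟨?_, ?_⟩⟩
    · exact (hU.isClosed_compl.notMem_iff_infDist_pos h).1 (by simpa using hx)
    · simpa using Metric.ball_infDist_compl_subset (s := U) (x := x)

variable {E : Type*} [NormedAddCommGroup E] [NormedSpace ℝ E] [FiniteDimensional ℝ E]

/-- The contraction of a contractible open set can be approximated by a smooth homotopy, whose ends
lie in convex neighbourhoods of the ends of the contraction. -/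
theorem exists_smooth_contraction {U : Set E} (hU : IsOpen U) [ContractibleSpace U] :
    ∃ x₀ ∈ U, ∃ L : E × ℝ → E, ContDiffOn ℝ ∞ L (U ×ˢ Set.univ) ∧
      Set.MapsTo L (U ×ˢ Set.univ) U ∧ ∃ ε : E → ℝ, (∀ x ∈ U, Metric.ball x (ε x) ⊆ U) ∧
        ∀ x ∈ U, L (x, 0) ∈ Metric.ball x (ε x) ∧ L (x, 1) ∈ Metric.ball x₀ (ε x₀) := by
  obtain ⟨x₀, ⟨K⟩⟩ := id_nullhomotopic U
  obtain ⟨ε, hεc, hε⟩ := exists_continuous_ball_subset hU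
  have hW : IsOpen (U ×ˢ (Set.univ : Set ℝ)) := hU.prod isOpen_univ
  let W : Opens (E × ℝ) := ⟨U ×ˢ Set.univ, hW⟩
  have : SecondCountableTopology E := secondCountable_of_proper
  have : LocallyCompactSpace W := hW.locallyCompactSpace
  have : SigmaCompactSpace W := sigmaCompactSpace_of_locallyCompact_secondCountable
  -- Clamping time to `[0, 1]` defines the contraction on an open set, as the smooth approximation
  -- needs.
  let k : W → U := fun z => K (Set.projIcc 0 1 zero_le_one z.1.2, ⟨z.1.1, z.2.1⟩)
  have hk : Continuous k := by
    refine K.continuous.comp (Continuous.prodMk ?_ ?_)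
    · exact continuous_projIcc.comp (continuous_snd.comp continuous_subtype_val)
    · exact (continuous_fst.comp continuous_subtype_val).subtype_mk _
  -- An error below `ε (k z)` keeps the approximation in `U`, and keeps its ends in balls about `x`
  -- and `x₀`, where straight lines are available.
  obtain ⟨g, hg, -⟩ := Continuous.exists_contMDiff_approx 𝓘(ℝ, E × ℝ) (⊤ : ℕ∞)
    (f := fun z => (k z : E)) (ε := fun z => ε (k z)) (continuous_subtype_val.comp hk)
    (hεc.comp (continuous_subtype_val.comp hk)) fun z => (hε _ (k z).2).1
  have hval : ∀ z : W, Function.extend Subtype.val g 0 (z : E × ℝ) = g z :=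
    fun z => Subtype.val_injective.extend_apply _ _ _
  have hL : ∀ z (hz : z ∈ U ×ˢ (Set.univ : Set ℝ)),
      Function.extend Subtype.val g 0 z ∈ Metric.ball (k ⟨z, hz⟩ : E) (ε (k ⟨z, hz⟩)) :=
    fun z hz => by
      have := hg ⟨z, hz⟩
      rw [← hval] at this
      exact this
  refine ⟨x₀, x₀.2, Function.extend Subtype.val g 0, fun z hz => ?_,
    fun z hz => (hε _ (k ⟨z, hz⟩).2).2 (hL z hz), ε, fun x hx => (hε x hx).2, fun x hx => ⟨?_, ?_⟩⟩
  · have h : ContMDiffAt 𝓘(ℝ, E × ℝ) 𝓘(ℝ, E) ∞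
        (fun z : W => Function.extend Subtype.val g 0 (z : E × ℝ)) ⟨z, hz⟩ := by
      simp only [hval]
      exact g.contMDiff _
    exact (contMDiffAt_subtype_iff.1 h).contDiffAt.contDiffWithinAt
  · have h := hL (x, 0) ⟨hx, trivial⟩
    have h' : k ⟨(x, 0), ⟨hx, trivial⟩⟩ = ⟨x, hx⟩ := by
      simp [k]
    rwa [h'] at h
  · have h := hL (x, 1) ⟨hx, trivial⟩
    have h' : k ⟨(x, 1), ⟨hx, trivial⟩⟩ = x₀ := by
      simp [k]
    rwa [h'] at h

end Contraction

/-! ### Triviality of the bundle over contractible domains -/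

section Contractible

variable {X : Type u} [DiffeologicalSpace X] {Q : GeneratingFamily X} {G : Type v} [AddCommGroup G]
  [DiffeologicalSpace G] [AbelianDiffeologicalGroup G] {F : Nebula Q → Nebula Q → G}

/-- Reparametrising time by `Real.smoothTransition` makes the homotopy stay in `U` for all real
times while only `[0, 1]` is constrained; local sections along `p` then pull back to those needed
for transport. -/
theorem IsSmoothCocycle.exists_section_homotopy (hF : IsSmoothCocycle F) {n : ℕ}
    {U : Set (EuclideanSpace ℝ (Fin n))} (hU : IsOpen U) (hne : U.Nonempty)
    {p : EuclideanSpace ℝ (Fin n) → X} (hp : PlotOn U p)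
    {H : EuclideanSpace ℝ (Fin n) × ℝ → EuclideanSpace ℝ (Fin n)}
    (hH : ContDiffOn ℝ ∞ H (U ×ˢ Set.univ)) (hHU : Set.MapsTo H (U ×ˢ Set.Icc 0 1) U)
    (h0 : ∃ σ, IsSection F U (fun u => p (H (u, 0))) σ) :
    ∃ σ, IsSection F U (fun u => p (H (u, 1))) σ := by
  let H' : EuclideanSpace ℝ (Fin n) × ℝ → EuclideanSpace ℝ (Fin n) :=
    fun z => H (z.1, Real.smoothTransition z.2)
  have hH' : ContDiffOn ℝ ∞ H' (U ×ˢ Set.univ) :=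
    hH.comp (contDiff_fst.prodMk
      (Real.smoothTransition.contDiff.comp contDiff_snd)).contDiffOn fun z hz => ⟨hz.1, trivial⟩
  have hHU' : Set.MapsTo H' (U ×ˢ Set.univ) U := fun z hz =>
    hHU ⟨hz.1, Real.smoothTransition.nonneg _, Real.smoothTransition.le_one _⟩
  have hW : IsOpen (U ×ˢ (Set.univ : Set ℝ)) := hU.prod isOpen_univ
  have := exists_section_transport (F := F) hU hne (P := fun z => p (H' z)) (hp.comp hH' hHU')
    (fun z hz => by
      obtain ⟨V, hV, hzV, hVU, σ, hσ⟩ := hF.exists_local_section hU hp (hHU' hz)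
      exact ⟨_, (hH'.continuousOn.isOpen_inter_preimage hW hV).mem_nhds ⟨hz, hzV⟩, _,
        hσ.comp (hH'.mono Set.inter_subset_left) fun z hz => hz.2⟩)
    (by simpa [H'] using h0)
  simpa [H'] using this

/-- Along a constant map the bundle has an obvious section. It is transported through three
homotopies: straight lines from `x₀` to `L (·, 1)`, then `L` backwards to `L (·, 0)`, then straight
lines to the identity. The lines stay in balls contained in `U`. -/
theorem IsSmoothCocycle.exists_section (hF : IsSmoothCocycle F) {n : ℕ}
    {U : Set (EuclideanSpace ℝ (Fin n))} (hU : IsOpen U) [ContractibleSpace U]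
    {p : EuclideanSpace ℝ (Fin n) → X} (hp : PlotOn U p) : ∃ σ, IsSection F U p σ := by
  obtain ⟨x₀, hx₀, L, hL, hLU, ε, hε, hεL⟩ := exists_smooth_contraction hU
  have hne : U.Nonempty := ⟨x₀, hx₀⟩
  have hL' : ∀ {φ : EuclideanSpace ℝ (Fin n) × ℝ → ℝ}, ContDiff ℝ ∞ φ →
      ContDiffOn ℝ ∞ (fun z : EuclideanSpace ℝ (Fin n) × ℝ => L (z.1, φ z)) (U ×ˢ Set.univ) :=
    fun hφ => hL.comp (contDiff_fst.prodMk hφ).contDiffOn fun z hz => ⟨hz.1, trivial⟩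
  have hline : ∀ {x y : EuclideanSpace ℝ (Fin n)} {t : ℝ}, x ∈ U → y ∈ Metric.ball x (ε x) →
      t ∈ Set.Icc (0 : ℝ) 1 → y + t • (x - y) ∈ U := fun {x y t} hx hy ht => by
    refine hε x hx ?_
    have hpos : 0 < ε x := Metric.pos_of_mem_ball hy
    exact (convex_ball x (ε x)).add_smul_sub_mem hy (Metric.mem_ball_self hpos) ht
  obtain ⟨a, ha⟩ := exists_ev_eq Q (p x₀)
  have s0 : ∃ σ, IsSection F U (fun _ => p x₀) σ :=
    ⟨_, hF.isSection (plotOn_const U a) fun _ _ => ha⟩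
  have s1 : ∃ σ, IsSection F U (fun u => p (L (u, 1))) σ := by
    have := hF.exists_section_homotopy hU hne hp
      (H := fun z => L (z.1, 1) + (1 - z.2) • (x₀ - L (z.1, 1)))
      ((hL' contDiff_const).add ((contDiff_const.sub contDiff_snd).contDiffOn.smul
        (contDiffOn_const.sub (hL' contDiff_const))))
      (fun z hz => hline hx₀ (hεL z.1 hz.1).2 ⟨by linarith [hz.2.2], by linarith [hz.2.1]⟩)
      (by simpa using s0)
    simpa using this
  have s2 : ∃ σ, IsSection F U (fun u => p (L (u, 0))) σ := by
    have := hF.exists_section_homotopy hU hne hp (H := fun z => L (z.1, 1 - z.2))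
      (hL' (contDiff_const.sub contDiff_snd)) (fun z hz => hLU ⟨hz.1, trivial⟩)
      (by simpa using s1)
    simpa using this
  have := hF.exists_section_homotopy hU hne hp
    (H := fun z => L (z.1, 0) + z.2 • (z.1 - L (z.1, 0)))
    ((hL' contDiff_const).add (contDiff_snd.contDiffOn.smul
      (contDiff_fst.contDiffOn.sub (hL' contDiff_const))))
    (fun z hz => hline hz.1 (hεL z.1 hz.1).1 hz.2) (by simpa using s2)
  simpa using this

end Contractible

/-! ### Degree one cocycles as functions of two points of the nebula -/

section CocycleFunctions

variable {X : Type u} [DiffeologicalSpace X] {Q R S : GeneratingFamily X} {G : Type v}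
  [AddCommGroup G] [DiffeologicalSpace G] [AbelianDiffeologicalGroup G]

open Classical in
/-- The value of a `1`-cochain on a pair of points, extended by zero to all pairs. -/
def pairValue (f : Cochains Q G 1) (a b : Nebula Q) : G :=
  if h : ev Q a = ev Q b then f.1 (NebulaPower.pair a b h) else 0

theorem pairValue_of_eq (f : Cochains Q G 1) {a b : Nebula Q} (h : ev Q a = ev Q b) :
    pairValue f a b = f.1 (NebulaPower.pair a b h) := dif_pos h

theorem apply_eq_pairValue (f : Cochains Q G 1) (x : NebulaPower Q 1) :
    f.1 x = pairValue f (x.1 0) (x.1 1) := by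
  rw [pairValue_of_eq f (x.2 0 1)]
  refine congrArg f.1 (Subtype.ext (funext fun i => ?_))
  fin_cases i <;> rfl

theorem isPlot_pairValue (f : Cochains Q G 1) {k : ℕ} {a b : EuclideanSpace ℝ (Fin k) → Nebula Q}
    (ha : IsPlot a) (hb : IsPlot b) (h : ∀ r, ev Q (a r) = ev Q (b r)) :
    IsPlot fun r => pairValue f (a r) (b r) := by
  have : (fun r => pairValue f (a r) (b r)) =
      fun r => f.1 (NebulaPower.pair (a r) (b r) (h r)) :=
    funext fun r => pairValue_of_eq f (h r)
  rw [this]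
  refine f.2 k (fun r => NebulaPower.pair (a r) (b r) (h r)) fun i => ?_
  fin_cases i
  · exact ha
  · exact hb

theorem coboundary_one_apply (f : Cochains Q G 1) (x : NebulaPower Q 2) :
    (coboundary Q G 1 f).1 x =
      pairValue f (x.1 1) (x.1 2) - pairValue f (x.1 0) (x.1 2) + pairValue f (x.1 0) (x.1 1) := by
  have : (coboundary Q G 1 f).1 x =
      f.1 (face Q 1 0 x) - f.1 (face Q 1 1 x) + f.1 (face Q 1 2 x) := by
    simp [coboundary, Fin.sum_univ_three, precomp, sub_eq_add_neg]
  rw [this]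
  simp only [apply_eq_pairValue]
  rfl

/-- A point of the nebula as an element of `N(Q)_0`. -/
def NebulaPower.point (y : Nebula Q) : NebulaPower Q 0 := ⟨fun _ => y, fun _ _ => rfl⟩

theorem coboundary_zero_apply (h : Cochains Q G 0) (x : NebulaPower Q 1) :
    (coboundary Q G 0 h).1 x =
      h.1 (NebulaPower.point (x.1 1)) - h.1 (NebulaPower.point (x.1 0)) := by
  have : (coboundary Q G 0 h).1 x = h.1 (face Q 0 0 x) - h.1 (face Q 0 1 x) := by
    simp [coboundary, precomp, sub_eq_add_neg]
  rw [this]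
  refine congrArg₂ _ (congrArg h.1 ?_) (congrArg h.1 ?_) <;>
    exact Subtype.ext (funext fun i => by fin_cases i; rfl)

theorem isSmoothCocycle_pairValue (f : cocycles Q G 1) : IsSmoothCocycle (pairValue f.1) where
  add a b c hab hbc := by
    have h0 : coboundary Q G 1 f.1 = 0 := f.2
    let x : NebulaPower Q 2 := ⟨![a, b, c], by
      intro i j
      fin_cases i <;> fin_cases j <;> simp [hab, hbc]⟩
    have h := coboundary_one_apply f.1 x
    rw [h0] at h
    have h' : (0 : G) = pairValue f.1 b c - pairValue f.1 a c + pairValue f.1 a b := h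
    rw [← sub_eq_zero, ← neg_eq_zero, h']
    abel
  smooth _ _ _ := isPlot_pairValue f.1

/-- The `1`-cocycle given by a function of two points of the nebula. -/
def IsSmoothCocycle.toCocycle {F : Nebula Q → Nebula Q → G} (hF : IsSmoothCocycle F) :
    cocycles Q G 1 :=
  ⟨⟨fun x => F (x.1 0) (x.1 1), fun _ p hp => hF.smooth (hp 0) (hp 1) fun r => (p r).2 0 1⟩,
    Subtype.ext <| funext fun x => by
      rw [coboundary_one_apply, pairValue_of_eq _ (x.2 _ _), pairValue_of_eq _ (x.2 _ _),
        pairValue_of_eq _ (x.2 _ _)]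
      change F (x.1 1) (x.1 2) - F (x.1 0) (x.1 2) + F (x.1 0) (x.1 1) = 0
      rw [hF.add (x.2 0 1) (x.2 1 2)]
      abel⟩

theorem IsSmoothCocycle.pairValue_toCocycle {F : Nebula Q → Nebula Q → G} (hF : IsSmoothCocycle F)
    {a b : Nebula Q} (h : ev Q a = ev Q b) : pairValue hF.toCocycle.1 a b = F a b :=
  pairValue_of_eq _ h

/-- Two `1`-cocycles are cohomologous if and only if they differ by `h b - h a`. -/
theorem mk_eq_mk_iff {f g : cocycles Q G 1} :
    (QuotientAddGroup.mk f : FamilyCohomology Q G 1) = QuotientAddGroup.mk g ↔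
      ∃ h : Nebula Q → G, DSmooth h ∧ ∀ a b, ev Q a = ev Q b →
        pairValue g.1 a b = pairValue f.1 a b + (h b - h a) := by
  rw [QuotientAddGroup.eq]
  constructor
  · rintro ⟨h, hh⟩
    refine ⟨fun y => h.1 (NebulaPower.point y), fun n p hp => h.2 n (fun r => NebulaPower.point (p r))
      fun _ => hp, fun a b hab => ?_⟩
    have h1 := congrArg (fun z : Cochains Q G 1 => z.1 (NebulaPower.pair a b hab)) hh
    simp only [coboundary_zero_apply] at h1
    rw [pairValue_of_eq _ hab, pairValue_of_eq _ hab]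
    have h2 : h.1 (NebulaPower.point b) - h.1 (NebulaPower.point a) =
      -f.1.1 (NebulaPower.pair a b hab) + g.1.1 (NebulaPower.pair a b hab) := h1
    rw [h2]
    abel
  · rintro ⟨h, hh, hfg⟩
    refine ⟨⟨fun x => h (x.1 0), fun n p hp => hh n _ (hp 0)⟩,
      Subtype.ext <| funext fun x => ?_⟩
    rw [coboundary_zero_apply]
    change h (x.1 1) - h (x.1 0) = -f.1.1 x + g.1.1 x
    rw [apply_eq_pairValue f.1, apply_eq_pairValue g.1, hfg _ _ (x.2 0 1)]
    abel

theorem Refinement.pairValue_cocycleMap (φ : Refinement Q R) (f : cocycles Q G 1) {a b : Nebula R}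
    (h : ev R a = ev R b) : pairValue (φ.cocycleMap G 1 f).1 a b =
      pairValue f.1 (φ.nebulaMap a) (φ.nebulaMap b) := by
  rw [pairValue_of_eq _ h]
  exact apply_eq_pairValue f.1 _

theorem Refinement.cohomologyMap_mk (φ : Refinement Q R) (f : cocycles Q G 1) :
    φ.cohomologyMap G 1 (QuotientAddGroup.mk f) = QuotientAddGroup.mk (φ.cocycleMap G 1 f) := rfl

/-- A map defined through lifts to the nebula is smooth if it is so along smooth lifts. -/
theorem dSmooth_of_lift {Y Z : Type*} [DiffeologicalSpace Y] [DiffeologicalSpace Z] {π : Z → X}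
    (hπ : DSmooth π) {k : Z → Y} {K : Z → Nebula R → Y}
    (hk : ∀ z y, ev R y = π z → k z = K z y)
    (hK : ∀ ⦃n : ℕ⦄ (z : EuclideanSpace ℝ (Fin n) → Z) (a : EuclideanSpace ℝ (Fin n) → Nebula R),
      IsPlot z → IsPlot a → (∀ r, ev R (a r) = π (z r)) → IsPlot fun r => K (z r) (a r)) :
    DSmooth k := fun n z hz => by
  refine isPlot_of_local fun x => ?_
  obtain ⟨V, hV, hxV, -, a, ha, h⟩ := exists_lift R isOpen_univ
    (IsPlot.plotOn (hπ n z hz) Set.univ) (Set.mem_univ x)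
  refine ⟨V, hV.mem_nhds hxV, fun m c hc hcV => ?_⟩
  have : (fun r => (k ∘ z) (c r)) = fun r => K (z (c r)) (a (c r)) :=
    funext fun r => hk _ _ (h _ (hcV r))
  rw [this]
  exact hK _ _ (isPlot_reparam hz hc) (ha c hc hcV) fun r => h _ (hcV r)

/-! ### Refinement maps in degree one, and their composites -/

namespace Refinement

variable (G)

/-- Any two refinement maps induce the same homomorphism. -/
theorem cohomologyMap_eq (φ ψ : Refinement Q R) : φ.cohomologyMap G 1 = ψ.cohomologyMap G 1 := by
  refine AddMonoidHom.ext fun a => ?_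
  obtain ⟨f, rfl⟩ := QuotientAddGroup.mk_surjective a
  have hF := isSmoothCocycle_pairValue f
  -- The cochain `y ↦ f (φ y, ψ y)` makes sense because both images lie over the same point of `X`.
  refine mk_eq_mk_iff.2 ⟨fun y => pairValue f.1 (φ.nebulaMap y) (ψ.nebulaMap y),
    fun n p hp => hF.smooth (φ.smooth_nebulaMap n p hp) (ψ.smooth_nebulaMap n p hp)
      fun r => (φ.ev_nebulaMap _).trans (ψ.ev_nebulaMap _).symm, fun a b hab => ?_⟩
  rw [pairValue_cocycleMap _ _ hab, pairValue_cocycleMap _ _ hab]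
  have e : ∀ y, ev Q (φ.nebulaMap y) = ev Q (ψ.nebulaMap y) :=
    fun y => (φ.ev_nebulaMap _).trans (ψ.ev_nebulaMap _).symm
  have e' : ev Q (φ.nebulaMap a) = ev Q (φ.nebulaMap b) := by
    rw [φ.ev_nebulaMap, φ.ev_nebulaMap, hab]
  have h1 := hF.add e' (e b)
  have h2 := hF.add (e a) ((e a).symm.trans (e'.trans (e b)))
  rw [h2] at h1
  rw [add_sub, ← h1]
  abel

/-- If `f` pulls back to the coboundary of `h`, then `f (φ y, u) + h y` is the same for every `y`
over `ev Q u`. As a function of `u` it is smooth, by local lifts to `N(R)`, and its coboundary is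
`f`. Contractibility plays no role. -/
theorem cohomologyMap_injective (φ : Refinement Q R) :
    Function.Injective (φ.cohomologyMap G 1) := by
  rw [injective_iff_map_eq_zero]
  intro a ha
  obtain ⟨f, rfl⟩ := QuotientAddGroup.mk_surjective a
  have hF := isSmoothCocycle_pairValue f
  obtain ⟨h, hh, hfh⟩ := mk_eq_mk_iff.1 (show (QuotientAddGroup.mk 0 : FamilyCohomology R G 1) =
    QuotientAddGroup.mk (φ.cocycleMap G 1 f) from ha.symm)
  have hfh' : ∀ y y', ev R y = ev R y' →
      pairValue f.1 (φ.nebulaMap y) (φ.nebulaMap y') = h y' - h y := fun y y' hy => by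
    rw [← pairValue_cocycleMap _ _ hy, hfh _ _ hy, pairValue_of_eq _ hy]
    exact zero_add _
  choose Y hY using exists_ev_eq R
  have key : ∀ u y, ev R y = ev Q u →
      pairValue f.1 (φ.nebulaMap (Y (ev Q u))) u + h (Y (ev Q u)) =
        pairValue f.1 (φ.nebulaMap y) u + h y := fun u y hy => by
    have hy' := (hY (ev Q u)).trans hy.symm
    have h1 := hF.add (a := φ.nebulaMap (Y (ev Q u))) (b := φ.nebulaMap y) (c := u)
      (by rw [φ.ev_nebulaMap, φ.ev_nebulaMap, hy']) ((φ.ev_nebulaMap y).trans hy)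
    rw [h1, hfh' _ _ hy']
    abel
  refine Eq.symm ((mk_eq_mk_iff (f := 0)).2
    ⟨fun u => pairValue f.1 (φ.nebulaMap (Y (ev Q u))) u + h (Y (ev Q u)), ?_, ?_⟩)
  · refine dSmooth_of_lift (R := R) (dSmooth_ev Q)
      (K := fun u y => pairValue f.1 (φ.nebulaMap y) u + h y) key fun n z a hz ha hza => ?_
    exact IsPlot.add (hF.smooth (φ.smooth_nebulaMap n a ha) hz
      fun r => (φ.ev_nebulaMap _).trans (hza r)) (hh n a ha)
  · intro a b hab
    have e : ∀ u, ev Q (φ.nebulaMap (Y (ev Q u))) = ev Q u :=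
      fun u => (φ.ev_nebulaMap _).trans (hY _)
    have h1 := hF.add (e a) hab
    rw [show pairValue (0 : cocycles Q G 1).1 a b = 0 from pairValue_of_eq _ hab, zero_add]
    simp only
    rw [← hab, h1]
    abel

/-- If the domains of `Q` are contractible, then every class on a refinement comes from `Q`. -/
theorem cohomologyMap_surjective (φ : Refinement Q R)
    (hQ : ∀ q ∈ Q.plots, ContractibleSpace q.domain) :
    Function.Surjective (φ.cohomologyMap G 1) := by
  classical
  intro a
  obtain ⟨f, rfl⟩ := QuotientAddGroup.mk_surjective a
  have hF := isSmoothCocycle_pairValue f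
  have hsec : ∀ q : Q.plots, ∃ (p : EuclideanSpace ℝ (Fin q.1.dim) → X)
      (σ : EuclideanSpace ℝ (Fin q.1.dim) → Nebula R → G),
      (∀ u : q.1.domain, p u = q.1.toFun u) ∧
      IsSection (pairValue f.1) (q.1.domain : Set _) p σ := fun q => by
    have hc : ContractibleSpace q.1.domain := hQ q.1 q.2
    have hc' : ContractibleSpace (q.1.domain : Set (EuclideanSpace ℝ (Fin q.1.dim))) := hc
    obtain ⟨u₀⟩ : Nonempty q.1.domain := inferInstance
    let p : EuclideanSpace ℝ (Fin q.1.dim) → X :=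
      Function.extend Subtype.val q.1.toFun fun _ => q.1.toFun u₀
    have hp : ∀ u : q.1.domain, p u = q.1.toFun u :=
      fun u => Subtype.val_injective.extend_apply _ _ _
    obtain ⟨σ, hσ⟩ := hF.exists_section q.1.domain.2 (plotOn_of_dSmooth_subtype q.1.smooth hp)
    exact ⟨p, σ, hp, hσ⟩
  choose p σ hp hσ using hsec
  -- The sections along the individual plots of `Q` assemble into one function on `N(Q) ×_X N(R)`.
  let s : Nebula Q → Nebula R → G := fun u y => σ u.1 u.2 y
  have hs_add : ∀ {u y y'}, ev R y = ev Q u → ev R y' = ev Q u →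
      s u y' = s u y + pairValue f.1 y y' := fun {u y y'} hy hy' =>
    (hσ u.1).add u.2.2 (hy.trans (hp u.1 u.2).symm) (hy'.trans (hp u.1 u.2).symm)
  have hs_smooth : ∀ ⦃n : ℕ⦄ (z : EuclideanSpace ℝ (Fin n) → Nebula Q)
      (a : EuclideanSpace ℝ (Fin n) → Nebula R), IsPlot z → IsPlot a →
      (∀ r, ev R (a r) = ev Q (z r)) → IsPlot fun r => s (z r) (a r) := fun n z a hz ha hza => by
    refine isPlot_of_local fun x => ?_
    obtain ⟨V, hxV, q, c, hc, hzc⟩ := hz x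
    refine ⟨V, V.2.mem_nhds hxV, fun m g hg hgV => ?_⟩
    have hzc' : ∀ r, z (g r) = ⟨q, c ⟨g r, hgV r⟩⟩ := fun r => hzc ⟨g r, hgV r⟩
    have : (fun r => s (z (g r)) (a (g r))) = fun r => σ q (c ⟨g r, hgV r⟩) (a (g r)) :=
      funext fun r => by rw [hzc' r]
    rw [this]
    have hcg : IsPlot fun r => c ⟨g r, hgV r⟩ := hc m (fun r => ⟨g r, hgV r⟩) hg.isPlot
    refine (hσ q).smooth (IsPlot.contDiff (X := EuclideanSpace ℝ (Fin q.1.dim)) hcg)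
      (fun r => (c ⟨g r, hgV r⟩).2) (isPlot_reparam ha hg) fun r =>
        (hza (g r)).trans ((congrArg (ev Q) (hzc' r)).trans (hp q _).symm)
  choose Y hY using exists_ev_eq R
  have key : ∀ u u' y, ev Q u = ev Q u' → ev R y = ev Q u →
      s u (Y (ev Q u)) - s u' (Y (ev Q u)) = s u y - s u' y := fun u u' y hu hy => by
    rw [hs_add (u := u) (hY (ev Q u)) hy, hs_add (u := u') ((hY (ev Q u)).trans hu) (hy.trans hu)]
    abel
  -- These are the transition functions of the chosen sections. By `key` the arbitrary point `Y` may
  -- be replaced by any point of the fibre, which gives smoothness.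
  have hF' : IsSmoothCocycle fun u u' => s u (Y (ev Q u)) - s u' (Y (ev Q u)) :=
    { add := fun a b c hab hbc => by
        rw [hab, hbc]
        abel
      smooth := fun n a b ha hb hab => by
        have hsm : DSmooth fun z : {z : Nebula Q × Nebula Q // ev Q z.1 = ev Q z.2} =>
            s z.1.1 (Y (ev Q z.1.1)) - s z.1.2 (Y (ev Q z.1.1)) := by
          have h1 : DSmooth fun z : {z : Nebula Q × Nebula Q // ev Q z.1 = ev Q z.2} => z.1.1 :=
            fun _ _ hz => hz.1
          have h2 : DSmooth fun z : {z : Nebula Q × Nebula Q // ev Q z.1 = ev Q z.2} => z.1.2 :=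
            fun _ _ hz => hz.2
          refine dSmooth_of_lift (R := R) ((dSmooth_ev Q).comp h1) (K := fun z y => s z.1.1 y - s z.1.2 y)
            (fun z y hy => key _ _ y z.2 hy) fun m z y hz hy hzy => ?_
          exact IsPlot.sub (hs_smooth _ _ (h1 m z hz) hy hzy)
            (hs_smooth _ _ (h2 m z hz) hy fun r => (hzy r).trans (z r).2)
        exact hsm n (fun r => ⟨(a r, b r), hab r⟩) ⟨ha, hb⟩ }
  refine ⟨QuotientAddGroup.mk hF'.toCocycle, ?_⟩
  rw [cohomologyMap_mk]
  -- Evaluating the new cocycle at the fibre point `b` shows that its pullback differs from `f` by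
  -- the coboundary of `y ↦ s (φ y) y`.
  refine mk_eq_mk_iff.2 ⟨fun y => s (φ.nebulaMap y) y, fun n z hz =>
    hs_smooth _ _ (φ.smooth_nebulaMap n z hz) hz fun r => (φ.ev_nebulaMap _).symm,
    fun a b hab => ?_⟩
  have e : ∀ y, ev Q (φ.nebulaMap y) = ev R y := φ.ev_nebulaMap
  have hab' : ev Q (φ.nebulaMap a) = ev Q (φ.nebulaMap b) := by rw [e, e, hab]
  rw [pairValue_cocycleMap _ _ hab, hF'.pairValue_toCocycle hab',
    key _ _ b hab' (by rw [e, hab]), hs_add (u := φ.nebulaMap a) (e a).symm (by rw [e, hab])]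
  abel

variable {G}

/-- The composite of two refinements. -/
def comp (φ : Refinement Q R) (ψ : Refinement R S) : Refinement Q S where
  index s := φ.index (ψ.index s)
  map s x := φ.map _ (ψ.map s x)
  smooth s := (φ.smooth _).comp (ψ.smooth s)
  comm s x := (φ.comm _ _).trans (ψ.comm s x)

variable (G) in
theorem cohomologyMap_comp (φ : Refinement Q R) (ψ : Refinement R S) (k : ℕ)
    (a : FamilyCohomology Q G k) :
    (φ.comp ψ).cohomologyMap G k a = ψ.cohomologyMap G k (φ.cohomologyMap G k a) := by
  obtain ⟨f, rfl⟩ := QuotientAddGroup.mk_surjective a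
  rfl

end Refinement

/-- A plot factors smoothly through a generating family. -/
def Plot.FactorsThrough (p : Plot X) (Q : GeneratingFamily X) : Prop :=
  ∃ (q : Q.plots) (f : p.domain → q.1.domain), DSmooth f ∧ ∀ x, q.1.toFun (f x) = p.toFun x

variable (Q R) in
/-- The generating family of all plots that factor through two given families. -/
def commonFamily : GeneratingFamily X where
  plots := {p | p.FactorsThrough Q ∧ p.FactorsThrough R}
  generating p x := by
    obtain ⟨V, hV, hxV, q, hq, f, hf, hfp⟩ := Q.generating p x
    obtain ⟨W, hW, hxW, r, hr, g, hg, hgp⟩ := R.generating p x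
    have hincl : ∀ {A B : Opens (EuclideanSpace ℝ (Fin p.dim))} (h : A ≤ B),
        DSmooth fun y : A => (⟨y, h y.2⟩ : B) := fun h n c hc => hc
    -- The restriction of `p` to `V ⊓ W` itself belongs to the family, so it factors through itself
    -- by the identity.
    refine ⟨V ⊓ W, inf_le_left.trans hV, ⟨hxV, hxW⟩,
      ⟨p.dim, V ⊓ W, fun y => p.toFun ⟨y, hV y.2.1⟩,
        p.smooth.comp (hincl (inf_le_left.trans hV))⟩, ⟨?_, ?_⟩, id, dSmooth_id, fun _ => rfl⟩
    · exact ⟨⟨q, hq⟩, fun y => f ⟨y, y.2.1⟩, hf.comp (hincl inf_le_left),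
        fun y => (hfp ⟨y, y.2.1⟩).symm⟩
    · exact ⟨⟨r, hr⟩, fun y => g ⟨y, y.2.2⟩, hg.comp (hincl inf_le_right),
        fun y => (hgp ⟨y, y.2.2⟩).symm⟩

/-- The factorizations are chosen arbitrarily; by `Refinement.cohomologyMap_eq` the choice is
invisible in degree-one cohomology. -/
theorem nonempty_refinement (h : ∀ r ∈ R.plots, Plot.FactorsThrough r Q) :
    Nonempty (Refinement Q R) := by
  choose i f hf hc using fun r : R.plots => h r.1 r.2
  exact ⟨⟨i, f, hf, hc⟩⟩

variable (Q R) in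
/-- A refinement of the first family by the common family. -/
def commonLeft : Refinement Q (commonFamily Q R) :=
  (nonempty_refinement (R := commonFamily Q R) fun _ hr => And.left hr).some

variable (Q R) in
/-- A refinement of the second family by the common family. -/
def commonRight : Refinement R (commonFamily Q R) :=
  (nonempty_refinement (R := commonFamily Q R) fun _ hr => And.right hr).some

theorem nonempty_refinement_commonFamily (φ : Refinement R S) :
    Nonempty (Refinement (commonFamily Q R) (commonFamily Q S)) :=
  nonempty_refinement fun p hp => ⟨⟨p, hp.1, by
    obtain ⟨s, f, hf, hc⟩ := hp.2
    exact ⟨φ.index s, fun x => φ.map s (f x), (φ.smooth s).comp hf,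
      fun x => (φ.comm s (f x)).trans (hc x)⟩⟩, id, dSmooth_id, fun _ => rfl⟩

end CocycleFunctions

/-! ### The colimit -/

section Colimit

variable {X : Type u} [DiffeologicalSpace X] {Q R S : GeneratingFamily X} (G : Type v)
  [AddCommGroup G] [DiffeologicalSpace G] [AbelianDiffeologicalGroup G]

theorem toCech_cohomologyMap (φ : Refinement Q R) (k : ℕ) (a : FamilyCohomology Q G k) :
    toCech R G k (φ.cohomologyMap G k a) = toCech Q G k a := by
  refine (QuotientAddGroup.eq.2 ?_).symm
  refine AddSubgroup.subset_closure ⟨Q, R, φ, a, ?_⟩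
  exact neg_add_eq_sub _ _

variable (hQ : ∀ q ∈ Q.plots, ContractibleSpace q.domain)

/-- The isomorphism between the cohomologies of a family with contractible domains and of a
refinement. -/
def Refinement.cohomologyEquiv (φ : Refinement Q R) :
    FamilyCohomology Q G 1 ≃+ FamilyCohomology R G 1 :=
  AddEquiv.ofBijective (φ.cohomologyMap G 1)
    ⟨φ.cohomologyMap_injective G, φ.cohomologyMap_surjective G hQ⟩

variable (R) in
/-- The homomorphism from the cohomology of any family to that of a family with contractible
domains. -/
def toContractible : FamilyCohomology R G 1 →+ FamilyCohomology Q G 1 :=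
  ((commonLeft Q R).cohomologyEquiv G hQ).symm.toAddMonoidHom.comp
    ((commonRight Q R).cohomologyMap G 1)

theorem cohomologyMap_toContractible (a : FamilyCohomology R G 1) :
    (commonLeft Q R).cohomologyMap G 1 (toContractible R G hQ a) =
      (commonRight Q R).cohomologyMap G 1 a :=
  ((commonLeft Q R).cohomologyEquiv G hQ).apply_symm_apply _

theorem toContractible_self (a : FamilyCohomology Q G 1) : toContractible Q G hQ a = a := by
  apply (commonLeft Q Q).cohomologyMap_injective G
  rw [cohomologyMap_toContractible, (commonLeft Q Q).cohomologyMap_eq G (commonRight Q Q)]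

/-- It is enough to compare in `commonFamily Q S`, where `commonLeft` is injective. That family also
refines `commonFamily Q R`, and all refinement maps between two fixed families agree on cohomology,
so the necessary diagrams commute. -/
theorem toContractible_cohomologyMap (φ : Refinement R S) (a : FamilyCohomology R G 1) :
    toContractible S G hQ (φ.cohomologyMap G 1 a) = toContractible R G hQ a := by
  obtain ⟨ψ⟩ := nonempty_refinement_commonFamily (Q := Q) φ
  apply (commonLeft Q S).cohomologyMap_injective G
  rw [cohomologyMap_toContractible, ← Refinement.cohomologyMap_comp,
    (φ.comp (commonRight Q S)).cohomologyMap_eq G ((commonRight Q R).comp ψ),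
    Refinement.cohomologyMap_comp, ← cohomologyMap_toContractible G hQ,
    ← Refinement.cohomologyMap_comp,
    ((commonLeft Q R).comp ψ).cohomologyMap_eq G (commonLeft Q S)]

theorem toCech_toContractible (a : FamilyCohomology R G 1) :
    toCech Q G 1 (toContractible R G hQ a) = toCech R G 1 a := by
  rw [← toCech_cohomologyMap G (commonLeft Q R), cohomologyMap_toContractible,
    toCech_cohomologyMap]

end Colimit

section Colimit

variable {X : Type u} [DiffeologicalSpace X] {Q : GeneratingFamily X} (G : Type v)
  [AddCommGroup G] [DiffeologicalSpace G] [AbelianDiffeologicalGroup G]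

/-- The first Čech cohomology is computed by any family with contractible domains. -/
theorem toCech_bijective (hQ : ∀ q ∈ Q.plots, ContractibleSpace q.domain) :
    Function.Bijective (toCech Q G 1) := by
  classical
  -- `Ψ` respects the colimit relations, and the map it induces is a left inverse of `toCech`.
  -- Surjectivity holds on each summand by passing to the common family.
  let Ψ : (⨁ R : GeneratingFamily X, FamilyCohomology R G 1) →+ FamilyCohomology Q G 1 :=
    DirectSum.toAddMonoid fun R => toContractible R G hQ
  have hof : ∀ (R : GeneratingFamily X) (a : FamilyCohomology R G 1),
      Ψ (DirectSum.of (fun R : GeneratingFamily X => FamilyCohomology R G 1) R a) =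
        toContractible R G hQ a := fun R a =>
    DirectSum.toAddMonoid_of (β := fun R : GeneratingFamily X => FamilyCohomology R G 1)
      (fun R => toContractible R G hQ) R a
  have hΨ : colimitRelations X G 1 ≤ Ψ.ker := by
    refine (AddSubgroup.closure_le _).2 ?_
    rintro _ ⟨R, S, φ, a, rfl⟩
    change Ψ _ = 0
    rw [map_sub, sub_eq_zero]
    exact (hof S _).trans ((toContractible_cohomologyMap G hQ φ a).trans (hof R a).symm)
  constructor
  · refine Function.LeftInverse.injective (g := QuotientAddGroup.lift _ Ψ hΨ) fun a => ?_
    exact (hof Q a).trans (toContractible_self G hQ a)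
  · intro z
    obtain ⟨z, rfl⟩ := QuotientAddGroup.mk_surjective z
    induction z using DirectSum.induction_on with
    | zero => exact ⟨0, map_zero _⟩
    | of R a => exact ⟨toContractible R G hQ a, toCech_toContractible G hQ a⟩
    | add x y hx hy =>
      obtain ⟨a, ha⟩ := hx
      obtain ⟨b, hb⟩ := hy
      exact ⟨a + b, by rw [map_add, ha, hb]; rfl⟩

end Colimit

/-! ### Actions of the relation groupoid on the trivial bundle over the nebula -/

section Actions

variable {X : Type u} [DiffeologicalSpace X] {Q : GeneratingFamily X} {G : Type v}
  [AddCommGroup G] [DiffeologicalSpace G]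

/-- An action commuting with translations is determined by its values at the points `(b, 0)`. -/
theorem NebulaAction.act_eq (A : NebulaAction Q G) {a b : Nebula Q} (h : ev Q a = ev Q b) (t : G) :
    A.act ⟨(⟨(a, b), h⟩, (b, t)), rfl⟩ = (a, (A.act ⟨(⟨(a, b), h⟩, (b, 0)), rfl⟩).2 + t) := by
  have h1 := A.act_translate ⟨(a, b), h⟩ (b, 0) rfl t
  have h2 : translate ((b, 0) : Nebula Q × G) t = (b, t) := by simp [translate]
  simp only [h2] at h1
  rw [h1]
  exact Prod.ext (A.anchor_act ⟨(⟨(a, b), h⟩, (b, 0)), rfl⟩) rfl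

open Classical in
/-- The cocycle of an action: `(a, b) · (b, 0) = (a, F a b)`. -/
def NebulaAction.cocycle (A : NebulaAction Q G) (a b : Nebula Q) : G :=
  if h : ev Q a = ev Q b then (A.act ⟨(⟨(a, b), h⟩, (b, 0)), rfl⟩).2 else 0

theorem NebulaAction.act_eq_cocycle (A : NebulaAction Q G) {a b : Nebula Q} (h : ev Q a = ev Q b)
    (t : G) : A.act ⟨(⟨(a, b), h⟩, (b, t)), rfl⟩ = (a, A.cocycle a b + t) := by
  rw [A.act_eq h, cocycle, dif_pos h]

/-- Additivity is associativity of the action, `(a, b) · ((b, c) · (c, 0)) = (a, c) · (c, 0)`. -/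
theorem NebulaAction.isSmoothCocycle (A : NebulaAction Q G) : IsSmoothCocycle A.cocycle where
  add a b c hab hbc := by
    have h := A.mul_act ⟨(a, b), hab⟩ ⟨(b, c), hbc⟩ (c, 0) rfl rfl
    have h1 := A.act_eq_cocycle hbc 0
    simp only [h1, A.act_eq_cocycle hab] at h
    have h2 := h.trans (A.act_eq_cocycle (hab.trans hbc) 0)
    simpa using (congrArg Prod.snd h2).symm
  smooth k a b ha hb hab := by
    have : (fun r => A.cocycle (a r) (b r)) =
        fun r => (A.act ⟨(⟨(a r, b r), hab r⟩, (b r, 0)), rfl⟩).2 :=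
      funext fun r => dif_pos (hab r)
    rw [this]
    exact (A.smooth_act k (fun r => ⟨(⟨(a r, b r), hab r⟩, (b r, 0)), rfl⟩)
      ⟨⟨ha, hb⟩, hb, isPlot_const⟩).2

variable [AbelianDiffeologicalGroup G]

/-- The action `(a, b) · (b, t) = (a, F a b + t)` defined by a cocycle. -/
def IsSmoothCocycle.nebulaAction {F : Nebula Q → Nebula Q → G} (hF : IsSmoothCocycle F) :
    NebulaAction Q G where
  act p := (p.1.1.1.1, F p.1.1.1.1 p.1.1.1.2 + p.1.2.2)
  smooth_anchor := fun _ _ hp => hp.1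
  smooth_act := fun _ p hp =>
    ⟨hp.1.1, IsPlot.add (hF.smooth hp.1.1 hp.1.2 fun r => (p r).1.1.2) hp.2.2⟩
  anchor_act _ := rfl
  mul_act := by
    rintro ⟨⟨a, b⟩, hab⟩ ⟨⟨b', c⟩, hbc⟩ ⟨c', t⟩ hgh hz
    have h1 : b = b' := hgh
    have h2 : c = c' := hz
    subst h1 h2
    refine Prod.ext rfl ?_
    change F a b + (F b c + t) = F a c + t
    rw [hF.add hab hbc, add_assoc]
  unit_act z := Prod.ext rfl (by
    change F z.1 z.1 + z.2 = z.2
    rw [hF.self, zero_add])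
  act_translate _ _ _ _ := Prod.ext rfl (add_assoc _ _ _).symm

/-- The action defined by a `1`-cocycle of the generating family. -/
def cocycleAction (f : cocycles Q G 1) : NebulaAction Q G :=
  (isSmoothCocycle_pairValue f).nebulaAction

theorem cocycleAction_act (f : cocycles Q G 1) {a b : Nebula Q} (h : ev Q a = ev Q b) (t : G) :
    (cocycleAction f).act ⟨(⟨(a, b), h⟩, (b, t)), rfl⟩ = (a, pairValue f.1 a b + t) := rfl

/-- Two cocycles define isomorphic actions if and only if they are cohomologous. -/
theorem cocycleAction_equiv_iff (f g : cocycles Q G 1) :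
    cocycleAction f ≈ cocycleAction g ↔
      (QuotientAddGroup.mk f : FamilyCohomology Q G 1) = QuotientAddGroup.mk g := by
  rw [mk_eq_mk_iff]
  constructor
  · rintro ⟨Φ, h, -, hΦ⟩
    have hval : ∀ y t, Φ (y, t) = (y, (Φ (y, 0)).2 + t) := fun y t => by
      have h1 := hΦ (y, 0) t
      have h2 : translate ((y, 0) : Nebula Q × G) t = (y, t) := by simp [translate]
      rw [h2] at h1
      rw [h1]
      exact Prod.ext (h.anchor (y, 0)) rfl
    -- With `k y = (Φ (y, 0)).2`, equivariance reads `f(a, b) + k a = g(a, b) + k b`, whence the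
    -- sign.
    refine ⟨fun y => -(Φ (y, 0)).2, fun n p hp =>
      IsPlot.neg (h.smooth n (fun r => (p r, 0)) ⟨hp, isPlot_const⟩).2, fun a b hab => ?_⟩
    have h1 := h.map_act ⟨(a, b), hab⟩ (b, 0) rfl
    have h2 : (Φ (a, pairValue f.1 a b + 0)).2 = pairValue g.1 a b + (Φ (b, 0)).2 :=
      congrArg Prod.snd h1
    rw [hval a (_ + 0)] at h2
    simp only [add_zero] at h2
    rw [← sub_eq_iff_eq_add.2 h2]
    simp only [sub_neg_eq_add]
    abel
  · rintro ⟨h, hh, hfg⟩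
    refine ⟨⟨fun z => (z.1, z.2 - h z.1), fun z => (z.1, z.2 + h z.1), fun z => by simp,
      fun z => by simp⟩, ⟨fun n p hp => ⟨hp.1, IsPlot.sub hp.2 (hh n _ hp.1)⟩, fun _ => rfl, ?_⟩,
      fun n p hp => ⟨hp.1, IsPlot.add hp.2 (hh n _ hp.1)⟩,
      fun z t => Prod.ext rfl (add_sub_right_comm _ _ _)⟩
    rintro ⟨⟨a, b⟩, hab⟩ ⟨b', t⟩ hz
    have hb : b = b' := hz
    subst hb
    refine Prod.ext rfl ?_
    change pairValue f.1 a b + t - h a = pairValue g.1 a b + (t - h b)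
    rw [hfg a b hab]
    abel

/-- An action commuting with translations coincides with the action of its own cocycle, so the
identity is the required isomorphism. -/
theorem exists_cocycleAction_equiv (A : NebulaAction Q G) :
    ∃ f : cocycles Q G 1, cocycleAction f ≈ A := by
  refine ⟨A.isSmoothCocycle.toCocycle, Equiv.refl _, ⟨dSmooth_id, fun _ => rfl, ?_⟩, dSmooth_id,
    fun _ _ => rfl⟩
  rintro ⟨⟨a, b⟩, hab⟩ ⟨b', t⟩ hz
  have hb : b = b' := hz
  subst hb
  change (cocycleAction A.isSmoothCocycle.toCocycle).act ⟨(⟨(a, b), hab⟩, (b, t)), rfl⟩ =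
    A.act ⟨(⟨(a, b), hab⟩, (b, t)), rfl⟩
  rw [cocycleAction_act, A.act_eq_cocycle hab, A.isSmoothCocycle.pairValue_toCocycle hab]

variable (Q G) in
/-- Cohomology classes of degree one correspond to isomorphism classes of actions. -/
def cohomologyEquivActionClasses : FamilyCohomology Q G 1 ≃ NebulaActionClasses Q G :=
  Equiv.ofBijective
    (Quotient.lift (fun f => (Quotient.mk _ (cocycleAction f) : NebulaActionClasses Q G))
      fun f g hfg => Quotient.sound ((cocycleAction_equiv_iff f g).2 (Quotient.sound hfg)))
    ⟨fun a b => by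
      obtain ⟨f, rfl⟩ := QuotientAddGroup.mk_surjective a
      obtain ⟨g, rfl⟩ := QuotientAddGroup.mk_surjective b
      exact fun h => (cocycleAction_equiv_iff f g).1 (Quotient.exact h), fun c => by
      obtain ⟨A, rfl⟩ := Quotient.exists_rep c
      obtain ⟨f, hf⟩ := exists_cocycleAction_equiv A
      exact ⟨QuotientAddGroup.mk f, Quotient.sound hf⟩⟩

theorem cohomologyEquivActionClasses_mk (f : cocycles Q G 1) :
    cohomologyEquivActionClasses Q G (QuotientAddGroup.mk f) = Quotient.mk _ (cocycleAction f) :=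
  rfl

end Actions

end

end DiffCech

theorem corollaryc {X : Type*} {G : Type*} [DiffeologicalSpace X] [AddCommGroup G]
    [DiffeologicalSpace G] [DiffCech.AbelianDiffeologicalGroup G]
    (Q : DiffCech.GeneratingFamily X) (hQ : ∀ q ∈ Q.plots, ContractibleSpace q.domain) :
    Function.Bijective (DiffCech.toCech Q G 1) ∧
    ∃ e : DiffCech.CechCohomology X G 1 ≃ DiffCech.NebulaActionClasses Q G,
      ∀ f : DiffCech.cocycles Q G 1, ∃ A : DiffCech.NebulaAction Q G,
        (∀ (y₁ y₂ : DiffCech.Nebula Q) (h : DiffCech.ev Q y₁ = DiffCech.ev Q y₂) (g : G),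
          A.act ⟨(⟨(y₁, y₂), h⟩, (y₂, g)), rfl⟩ =
            (y₁, f.1.1 (DiffCech.NebulaPower.pair y₁ y₂ h) + g)) ∧
        e (DiffCech.toCech Q G 1 (QuotientAddGroup.mk f)) = Quotient.mk _ A := by
  have hb := DiffCech.toCech_bijective G hQ
  refine ⟨hb, (Equiv.ofBijective _ hb).symm.trans (DiffCech.cohomologyEquivActionClasses Q G),
    fun f => ⟨DiffCech.cocycleAction f, fun y₁ y₂ h g => ?_, ?_⟩⟩
  · rw [DiffCech.cocycleAction_act, DiffCech.pairValue_of_eq]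
  · rw [Equiv.trans_apply, Equiv.ofBijective_symm_apply_apply,
      DiffCech.cohomologyEquivActionClasses_mk]
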